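/- Let $\langle X,Y\rangle$ be the free monoid of words in two noncommuting letters, and let $\beta=(\beta_w)_{|w|\le 4}$ be a real sequence indexed by the words of length at most $4$ which is tracial: $\beta_v=\beta_w$ whenever $v$ is a cyclic permutation of $w$, and $\beta_{w^*}=\beta_w$, where $w^*$ is the reverse of $w$. Assume that $\beta$ is normalized ($\beta_1=1$) and noncommutative ($\beta_{X^2Y^2}\ne\beta_{XYXY}$). Let $\mathcal M_2=(\beta_{U^*V})_{U,V\in\{1,X,Y,X^2,XY,YX,Y^2\}}$ be its moment matrix, and let $w(\mathbb X,\mathbb Y)$ denote the column of $\mathcal M_2$ indexed by $w$, with $\mathbb 1$ the column indexed by the empty word. A representing measure for $\beta$ consists of finitely many pairs (atoms) $(A_i,B_i)$ of real symmetric $t_i\times t_i$ matrices, $t_i\ge 1$, with densities $\lambda_i>0$, $\sum_i\lambda_i=1$, such that $\beta_w=\sum_i\lambda_i\frac1{t_i}\operatorname{tr}\big(w(A_i,B_i)\big)$ for all $|w|\le 4$. It is of type $(m_1,\dots,m_r)$ if it has exactly $m_s$ atoms of size $s$ for $s\le r$, none of size $>r$, and $m_r\neq0$. It is minimal if no other representing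 measure has a type $(m_1',\dots,m_{r'}')$ with $r'<r$, or with $r'=r$ and $m'_s<m_s$ for the largest $s$ such that $m'_s\ne m_s$. The sequence $\beta$ admits an nc measure if it has a minimal representing measure of type $(m_1,\dots,m_r)$ with $r>1$. Two representing measures are orthogonally equivalent if, after a bijection between their atoms, corresponding atoms have equal densities and are conjugate by a common orthogonal matrix, $(A,B)\mapsto(UAU^t,UBU^t)$. Theorem. Suppose that $\mathcal M_2$ has rank $5$ and satisfies the column relations $\mathbb{XY}+\mathbb{YX}=\mathbf 0$ and $\mathbb X^2+\mathbb Y^2=\mathbb 1$. Then $\beta$ admits an nc measure if and only if $$|\beta_Y|<1-|\beta_X|,\qquad |\beta_X|<\beta_{X^2}<1-|\beta_Y|,\qquad c\le\beta_{X^4}<\beta_{X^2},$$ where $$c=\frac{-\beta_{X^2}^2-|\beta_X|+2\beta_{X^2}|\beta_X|+|\beta_Y\beta_X|}{-1+|\beta_Y|+|\beta_X|}.$$ Moreover, if $\beta$ admits an nc measure, then, counting up to orthogonal equivalence: 1. there is exactly one minimal measure, and it is of type $(1,1)$, if and only if $\beta_X\beta_Y=0$ and $\beta_{X^4}=c$;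 2. there is exactly one minimal measure, and it is of type $(2,1)$, if and only if either exactly one of $\beta_X,\beta_Y$ is zero and $\beta_{X^4}\ne c$, or $\beta_X\beta_Y\neq0$ and $\beta_{X^4}=c$; 3. there are exactly two minimal measures, and both are of type $(2,1)$, if and only if $\beta_X=\beta_Y=0$; 4. there are exactly two minimal measures, and both are of type $(3,1)$, if and only if $\beta_X\beta_Y\ne0$ and $\beta_{X^4}\ne c$. -/

import Mathlib

namespace TracialMoment

/-- The two noncommuting letters. -/
inductive Letter
  | X
  | Y

/-- Words in the noncommuting letters `X`, `Y`; the empty list is the word `1`. -/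
abbrev Word := List Letter

/-- The matrix `w(A, B)`. -/
def evalWord {t : ℕ} (A B : Matrix (Fin t) (Fin t) ℝ) (w : Word) : Matrix (Fin t) (Fin t) ℝ :=
  (w.map fun l => match l with
    | Letter.X => A
    | Letter.Y => B).prod

/-- A quartic tracial sequence `(β_w)_{|w| ≤ 4}`: invariant under cyclic permutations and reversal.
Only the values of `β` on words of length at most `4` are ever used. -/
def IsTracial (β : Word → ℝ) : Prop :=
  (∀ v w : Word, v.length ≤ 4 → v.IsRotated w → β v = β w) ∧
  (∀ w : Word, w.length ≤ 4 → β w.reverse = β w)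

/-- `β` is normalized. -/
def IsNormalized (β : Word → ℝ) : Prop := β [] = 1

open Letter in
/-- `β` is a noncommutative sequence. -/
def IsNoncommutative (β : Word → ℝ) : Prop := β [X, X, Y, Y] ≠ β [X, Y, X, Y]

open Letter in
/-- The words of length at most two in degree-lexicographic order:
`1, X, Y, X², XY, YX, Y²`. -/
def wordsTwo : Fin 7 → Word :=
  ![[], [X], [Y], [X, X], [X, Y], [Y, X], [Y, Y]]

/-- The truncated moment matrix of order two: the entry in row `U` and column `V` is `β_{U* V}`. -/
def momentMatrix (β : Word → ℝ) : Matrix (Fin 7) (Fin 7) ℝ :=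
  Matrix.of fun i j => β ((wordsTwo i).reverse ++ wordsTwo j)

/-- A finitely atomic tracial measure: finitely many pairs of real symmetric matrices
(`atomX i`, `atomY i`) of size `size i ≥ 1` with positive densities of sum one. -/
structure AtomicMeasure where
  N : ℕ
  size : Fin N → ℕ
  size_pos : ∀ i, 0 < size i
  density : Fin N → ℝ
  density_pos : ∀ i, 0 < density i
  sum_density : ∑ i, density i = 1
  atomX : ∀ i, Matrix (Fin (size i)) (Fin (size i)) ℝ
  atomY : ∀ i, Matrix (Fin (size i)) (Fin (size i)) ℝ
  symmX : ∀ i, (atomX i).IsSymm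
  symmY : ∀ i, (atomY i).IsSymm

namespace AtomicMeasure

/-- The moment of `w`: the sum of the densities times the normalized traces of `w` at the atoms. -/
noncomputable def moment (μ : AtomicMeasure) (w : Word) : ℝ :=
  ∑ i, μ.density i * ((μ.size i : ℝ)⁻¹ * (evalWord (μ.atomX i) (μ.atomY i) w).trace)

/-- `μ` is a representing measure for `(β_w)_{|w| ≤ 4}`. -/
def Represents (μ : AtomicMeasure) (β : Word → ℝ) : Prop :=
  ∀ w : Word, w.length ≤ 4 → β w = μ.moment w

/-- The number of atoms of size `s`. -/
def atomCount (μ : AtomicMeasure) (s : ℕ) : ℕ :=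
  (Finset.univ.filter fun i => μ.size i = s).card

/-- The largest size of an atom. -/
def maxSize (μ : AtomicMeasure) : ℕ := Finset.univ.sup μ.size

/-- The type `(m₁, …, m_r)`: `m_s` is the number of atoms of size `s`, and `r` is the largest
size that occurs. -/
def type (μ : AtomicMeasure) : List ℕ :=
  (List.range μ.maxSize).map fun k => μ.atomCount (k + 1)

/-- The type of `ν` is strictly smaller than the type of `μ`: either the largest size is smaller,
or the largest sizes agree and, at the largest size at which the numbers of atoms differ,
`ν` has fewer atoms. -/
def SmallerType (ν μ : AtomicMeasure) : Prop :=
  ν.maxSize < μ.maxSize ∨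
    (ν.maxSize = μ.maxSize ∧
      ∃ s, ν.atomCount s < μ.atomCount s ∧ ∀ s', s < s' → ν.atomCount s' = μ.atomCount s')

/-- `μ` is a minimal representing measure for `β`. -/
def IsMinimal (μ : AtomicMeasure) (β : Word → ℝ) : Prop :=
  μ.Represents β ∧ ∀ ν : AtomicMeasure, ν.Represents β → ¬ ν.SmallerType μ

/-- Orthogonal equivalence: after a bijection of the atoms, the densities agree and corresponding
atoms are conjugate by an orthogonal matrix (the two equations for `U` force equal sizes). -/
def OrthEquiv (μ ν : AtomicMeasure) : Prop :=
  ∃ σ : Fin μ.N ≃ Fin ν.N, ∀ i, μ.density i = ν.density (σ i) ∧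
    ∃ U : Matrix (Fin (ν.size (σ i))) (Fin (μ.size i)) ℝ,
      U * U.transpose = 1 ∧ U.transpose * U = 1 ∧
      ν.atomX (σ i) = U * μ.atomX i * U.transpose ∧
      ν.atomY (σ i) = U * μ.atomY i * U.transpose

end AtomicMeasure

/-- `β` admits an nc measure: it has a minimal representing measure whose largest atom has
size greater than one. -/
def AdmitsNCMeasure (β : Word → ℝ) : Prop :=
  ∃ μ : AtomicMeasure, μ.IsMinimal β ∧ 1 < μ.maxSize

/-- Up to orthogonal equivalence there is exactly one minimal measure for `β`, and its type
is `t`. -/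
def HasUniqueMinimal (β : Word → ℝ) (t : List ℕ) : Prop :=
  ∃ μ : AtomicMeasure, μ.IsMinimal β ∧ μ.type = t ∧
    ∀ ν : AtomicMeasure, ν.IsMinimal β → ν.OrthEquiv μ

/-- Up to orthogonal equivalence there are exactly two minimal measures for `β`, and their type
is `t`. -/
def HasExactlyTwoMinimal (β : Word → ℝ) (t : List ℕ) : Prop :=
  ∃ μ₁ μ₂ : AtomicMeasure, μ₁.IsMinimal β ∧ μ₂.IsMinimal β ∧ μ₁.type = t ∧ μ₂.type = t ∧
    ¬ μ₁.OrthEquiv μ₂ ∧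
    ∀ ν : AtomicMeasure, ν.IsMinimal β → ν.OrthEquiv μ₁ ∨ ν.OrthEquiv μ₂

open Letter in
/-- The lower bound `c` for `β_{X⁴}`. -/
noncomputable def lowerBound (β : Word → ℝ) : ℝ :=
  (-(β [X, X]) ^ 2 - |β [X]| + 2 * β [X, X] * |β [X]| + |β [Y] * β [X]|) /
    (-1 + |β [Y]| + |β [X]|)

end TracialMoment

/-!
In the weighted trace `τ` on the algebra that contains the atoms, `X²` commutes with the involution
`T = X + Y`, so `τ(s²T) ≤ τ(s²)` for `s = X² - t`. Together with the sign changes of `X` and `Y`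
this says that, for all real `t`,
`β_{X²Y²} ≤ (1 - t)² (β_{X²} - |β_X|) + t² (β_{Y²} - |β_Y|)`.
Optimizing in `t`, the hyperbola `1/x + 1/y = 1/β_{X²Y²}` meets the box
`(0, β_{X²} - |β_X|] × (0, β_{Y²} - |β_Y|]`.

Conversely, the points of this arc of the hyperbola parametrize the measures whose atoms are one
irreducible pair of size two, determined up to conjugation by the scalar `X²`, and some of the four
points `(±1, 0)`, `(0, ±1)`. The number of these points is least at end points of the arc only, and
the two end points coincide if and only if `β_{X⁴}` equals its lower bound.
-/

namespace TracialMoment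

open Letter Matrix

section CirclePair

/-- Self-adjoint solutions of the relations `XY + YX = 0` and `X² + Y² = 1` in a star ring. -/
structure IsCirclePair {R : Type*} [Ring R] [StarRing R] (a b : R) : Prop where
  selfAdjoint_left : IsSelfAdjoint a
  selfAdjoint_right : IsSelfAdjoint b
  anticomm : a * b + b * a = 0
  sq_add_sq : a ^ 2 + b ^ 2 = 1

/-- A positive linear functional which is also a trace. -/
structure IsPositiveTrace {R : Type*} [Ring R] [StarRing R] [Algebra ℝ R] (τ : R →ₗ[ℝ] ℝ) :
    Prop where
  mul_comm : ∀ a b, τ (a * b) = τ (b * a)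
  nonneg : ∀ a, 0 ≤ τ (star a * a)

variable {R : Type*} [Ring R] [StarRing R] {a b : R}

namespace IsCirclePair

theorem swap (h : IsCirclePair a b) : IsCirclePair b a :=
  ⟨h.selfAdjoint_right, h.selfAdjoint_left, by rw [add_comm, h.anticomm],
    by rw [add_comm, h.sq_add_sq]⟩

theorem neg_left (h : IsCirclePair a b) : IsCirclePair (-a) b :=
  ⟨h.selfAdjoint_left.neg, h.selfAdjoint_right,
    by rw [neg_mul, mul_neg, ← neg_add, h.anticomm, neg_zero], by rw [neg_sq, h.sq_add_sq]⟩

theorem neg_right (h : IsCirclePair a b) : IsCirclePair a (-b) :=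
  h.swap.neg_left.swap

theorem mul_eq_neg (h : IsCirclePair a b) : a * b = -(b * a) :=
  eq_neg_of_add_eq_zero_left h.anticomm

theorem commute_sq (h : IsCirclePair a b) : Commute (a ^ 2) b := by
  rw [Commute, SemiconjBy, sq, mul_assoc, h.mul_eq_neg, mul_neg, ← mul_assoc, h.mul_eq_neg,
    neg_mul, neg_neg, mul_assoc]

theorem add_sq (h : IsCirclePair a b) : (a + b) ^ 2 = 1 := by
  rw [← h.sq_add_sq, ← add_zero (a ^ 2 + b ^ 2), ← h.anticomm]
  noncomm_ring

end IsCirclePair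

namespace IsPositiveTrace

variable [Algebra ℝ R] {τ : R →ₗ[ℝ] ℝ}

theorem sq_nonneg (hτ : IsPositiveTrace τ) (ha : IsSelfAdjoint a) : 0 ≤ τ (a ^ 2) := by
  simpa only [ha.star_eq, sq] using hτ.nonneg a

theorem mul_sq_eq_zero (hτ : IsPositiveTrace τ) {c : R} (h : c * b = -(b * c)) :
    τ (c * b ^ 2) = 0 := by
  have key : τ (c * b ^ 2) = -τ (c * b ^ 2) := by
    conv_lhs => rw [sq, ← mul_assoc, h, neg_mul, map_neg, mul_assoc, hτ.mul_comm, mul_assoc, ← sq]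
  linarith

theorem sq_mul_le_of_involution (hτ : IsPositiveTrace τ) {s T : R} (hs : IsSelfAdjoint s)
    (hT : IsSelfAdjoint T) (hsT : Commute s T) (hT₂ : T ^ 2 = 1) : τ (s ^ 2 * T) ≤ τ (s ^ 2) := by
  have hcomm : Commute s (1 - T) := (Commute.one_right s).sub_right hsT
  have hsq : (s * (1 - T)) ^ 2 = s ^ 2 - s ^ 2 * T + (s ^ 2 - s ^ 2 * T) := by
    rw [hcomm.mul_pow, show (1 - T) ^ 2 = 1 - T + (T ^ 2 - T) by noncomm_ring, hT₂]
    noncomm_ring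
  have hself : IsSelfAdjoint (s * (1 - T)) :=
    (hs.commute_iff ((IsSelfAdjoint.one R).sub hT)).1 hcomm
  have h := hτ.sq_nonneg hself
  rw [hsq, map_add, map_sub] at h
  linarith

end IsPositiveTrace

namespace IsCirclePair

variable [Algebra ℝ R] {τ : R →ₗ[ℝ] ℝ}

theorem trace_sq_mul_sq_nonneg (h : IsCirclePair a b) (hτ : IsPositiveTrace τ) :
    0 ≤ τ (a ^ 2 * b ^ 2) := by
  have key : a ^ 2 * b ^ 2 = star (b * a) * (b * a) := by
    rw [star_mul, h.selfAdjoint_left.star_eq, h.selfAdjoint_right.star_eq, sq a, mul_assoc,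
      ← h.swap.commute_sq.eq, sq b]
    noncomm_ring
  exact key ▸ hτ.nonneg (b * a)

theorem trace_sq_sub_smul_mul (h : IsCirclePair a b) (hτ : IsPositiveTrace τ) (t : ℝ) :
    τ ((a ^ 2 - t • 1) ^ 2 * b) = t ^ 2 * τ b := by
  have hanti : b * (a ^ 2 - (2 * t) • 1) * a = -(a * (b * (a ^ 2 - (2 * t) • 1))) := by
    rw [← mul_assoc a b, h.mul_eq_neg, neg_mul, neg_neg, mul_assoc, mul_assoc]
    simp only [sub_mul, mul_sub, smul_mul_assoc, mul_smul_comm, one_mul, mul_one, ← pow_succ,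
      ← pow_succ']
  have hsplit : (a ^ 2 - t • 1) ^ 2 * b = b * (a ^ 2 - (2 * t) • 1) * a ^ 2 + t ^ 2 • b := by
    have hb : (a ^ 2 - t • 1) ^ 2 * b = b * (a ^ 2 - t • 1) ^ 2 :=
      ((h.commute_sq.sub_left ((Commute.one_left b).smul_left t)).pow_left 2).eq
    rw [hb, sq (a ^ 2 - t • 1)]
    simp only [sub_mul, mul_sub, smul_mul_assoc, mul_smul_comm, one_mul, mul_one, smul_smul,
      mul_assoc, smul_sub]
    module
  rw [hsplit, map_add, hτ.mul_sq_eq_zero hanti, zero_add, map_smul, smul_eq_mul]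

theorem sq_sub_smul_eq_neg (h : IsCirclePair a b) (t : ℝ) :
    a ^ 2 - t • (1 : R) = -(b ^ 2 - (1 - t) • 1) := by
  rw [eq_sub_of_add_eq' h.sq_add_sq]
  module

theorem trace_sq_sub_smul_sq (h : IsCirclePair a b) (t : ℝ) :
    τ ((a ^ 2 - t • 1) ^ 2) =
      (1 - t) ^ 2 * τ (a ^ 2) + t ^ 2 * τ (b ^ 2) - τ (a ^ 2 * b ^ 2) := by
  have key : (a ^ 2 - t • 1) ^ 2 = (1 - t) ^ 2 • a ^ 2 + t ^ 2 • b ^ 2 - a ^ 2 * b ^ 2 := by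
    rw [eq_sub_of_add_eq' h.sq_add_sq, sq (a ^ 2 - t • 1)]
    simp only [sub_mul, mul_sub, smul_mul_assoc, mul_smul_comm, one_mul, mul_one, smul_sub]
    module
  simp only [key, map_sub, map_add, map_smul, smul_eq_mul]

variable [StarModule ℝ R]

/-- With `s = X² - t` and the involution `T = X + Y`, this is the inequality `τ(s²T) ≤ τ(s²)`. -/
theorem weighted_trace_le (h : IsCirclePair a b) (hτ : IsPositiveTrace τ) (t : ℝ) :
    (1 - t) ^ 2 * τ a + t ^ 2 * τ b ≤
      (1 - t) ^ 2 * τ (a ^ 2) + t ^ 2 * τ (b ^ 2) - τ (a ^ 2 * b ^ 2) := by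
  have ha : τ ((a ^ 2 - t • 1) ^ 2 * a) = (1 - t) ^ 2 * τ a := by
    rw [h.sq_sub_smul_eq_neg t, neg_sq, h.swap.trace_sq_sub_smul_mul hτ]
  have hs : IsSelfAdjoint (a ^ 2 - t • (1 : R)) :=
    (h.selfAdjoint_left.pow 2).sub ((IsSelfAdjoint.all t).smul (IsSelfAdjoint.one R))
  have hcomm : Commute (a ^ 2 - t • (1 : R)) (a + b) :=
    (((Commute.refl a).pow_left 2).add_right h.commute_sq).sub_left
      ((Commute.one_left (a + b)).smul_left t)
  have key := hτ.sq_mul_le_of_involution hs (h.selfAdjoint_left.add h.selfAdjoint_right) hcomm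
    h.add_sq
  rwa [mul_add, map_add, ha, h.trace_sq_sub_smul_mul hτ, h.trace_sq_sub_smul_sq] at key

theorem weighted_abs_trace_le (h : IsCirclePair a b) (hτ : IsPositiveTrace τ) (t : ℝ) :
    τ (a ^ 2 * b ^ 2) ≤
      (1 - t) ^ 2 * (τ (a ^ 2) - |τ a|) + t ^ 2 * (τ (b ^ 2) - |τ b|) := by
  have hpp := h.weighted_trace_le hτ t
  have hnp := h.neg_left.weighted_trace_le hτ t
  have hpn := h.neg_right.weighted_trace_le hτ t
  have hnn := h.neg_left.neg_right.weighted_trace_le hτ t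
  simp only [map_neg, neg_sq] at hnp hpn hnn
  rcases abs_choice (τ a) with ha | ha <;> rcases abs_choice (τ b) with hb | hb <;> rw [ha, hb] <;>
    linarith

end IsCirclePair

end CirclePair

section CircleRelations

/-- A normalized tracial sequence satisfying the relations `XY + YX = 0` and `X² + Y² = 1` on the
words of length at most four. -/
structure CircleRelations (β : Word → ℝ) : Prop where
  tracial : IsTracial β
  one : β [] = 1
  anticomm : ∀ r : Word, r.length ≤ 2 → β (r ++ [X, Y]) + β (r ++ [Y, X]) = 0
  circle : ∀ r : Word, r.length ≤ 2 → β (r ++ [X, X]) + β (r ++ [Y, Y]) = β r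

theorem exists_wordsTwo_reverse {r : Word} (hr : r.length ≤ 2) :
    ∃ i, (wordsTwo i).reverse = r := by
  match r, hr with
  | [], _ => exact ⟨0, rfl⟩
  | [X], _ => exact ⟨1, rfl⟩
  | [Y], _ => exact ⟨2, rfl⟩
  | [X, X], _ => exact ⟨3, rfl⟩
  | [Y, X], _ => exact ⟨4, rfl⟩
  | [X, Y], _ => exact ⟨5, rfl⟩
  | [Y, Y], _ => exact ⟨6, rfl⟩
  | _ :: _ :: _ :: _, h => simp at h

namespace CircleRelations

theorem of_momentMatrix {β : Word → ℝ} (htracial : IsTracial β) (hnorm : IsNormalized β)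
    (hXY : (momentMatrix β).col 4 + (momentMatrix β).col 5 = 0)
    (hXX : (momentMatrix β).col 3 + (momentMatrix β).col 6 = (momentMatrix β).col 0) :
    CircleRelations β where
  tracial := htracial
  one := hnorm
  anticomm r hr := by
    obtain ⟨i, rfl⟩ := exists_wordsTwo_reverse hr
    exact congrFun hXY i
  circle r hr := by
    obtain ⟨i, rfl⟩ := exists_wordsTwo_reverse hr
    have h : β ((wordsTwo i).reverse ++ [X, X]) + β ((wordsTwo i).reverse ++ [Y, Y]) =
      β ((wordsTwo i).reverse ++ []) := congrFun hXX i
    rwa [List.append_nil] at h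

variable {β γ : Word → ℝ}

theorem rotate (h : CircleRelations β) (n : ℕ) {v : Word} (hv : v.length ≤ 4) :
    β v = β (v.rotate n) :=
  h.tracial.1 v _ hv ⟨n, rfl⟩

theorem apply_YY (h : CircleRelations β) : β [Y, Y] = 1 - β [X, X] := by
  have := h.circle [] (by simp)
  simp only [List.nil_append, h.one] at this
  linarith

theorem apply_XXXX (h : CircleRelations β) : β [X, X, X, X] = β [X, X] - β [X, X, Y, Y] :=
  eq_sub_of_add_eq (h.circle [X, X] (by simp))

theorem apply_XYXY (h : CircleRelations β) : β [X, Y, X, Y] = -β [X, X, Y, Y] := by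
  have hrot : β [X, X, Y, Y] = β [X, Y, Y, X] := h.rotate 1 (by simp)
  exact hrot ▸ eq_neg_of_add_eq_zero_left (h.anticomm [X, Y] (by simp))

/-- The value at `w` of the functional satisfying the circle relations with prescribed values
`a, b, p, d` at `X, Y, X², X²Y²`. -/
def circleValue (a b p d : ℝ) : Word → ℝ
  | [] => 1
  | [X] => a
  | [Y] => b
  | [X, X] => p
  | [Y, Y] => 1 - p
  | [X, X, X] => a
  | [Y, Y, Y] => b
  | [X, X, X, X] => p - d
  | [Y, Y, Y, Y] => 1 - p - d
  | [X, X, Y, Y] => d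
  | [X, Y, Y, X] => d
  | [Y, Y, X, X] => d
  | [Y, X, X, Y] => d
  | [X, Y, X, Y] => -d
  | [Y, X, Y, X] => -d
  | _ => 0

theorem eq_circleValue_two (h : CircleRelations β) (l₁ l₂ : Letter) :
    β [l₁, l₂] = circleValue (β [X]) (β [Y]) (β [X, X]) (β [X, X, Y, Y]) [l₁, l₂] := by
  have hrot : β [X, Y] = β [Y, X] := h.rotate 1 (v := [X, Y]) (by simp)
  have hanti : β [X, Y] + β [Y, X] = 0 := h.anticomm [] (by simp)
  have hcirc := h.apply_YY
  cases l₁ <;> cases l₂ <;> simp only [circleValue] <;> linarith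

theorem eq_circleValue_three (h : CircleRelations β) (l₁ l₂ l₃ : Letter) :
    β [l₁, l₂, l₃] =
      circleValue (β [X]) (β [Y]) (β [X, X]) (β [X, X, Y, Y]) [l₁, l₂, l₃] := by
  have rotXXY₁ : β [X, X, Y] = β [X, Y, X] := h.rotate 1 (by simp)
  have rotXXY₂ : β [X, X, Y] = β [Y, X, X] := h.rotate 2 (by simp)
  have rotXYY₁ : β [X, Y, Y] = β [Y, Y, X] := h.rotate 1 (by simp)
  have rotXYY₂ : β [X, Y, Y] = β [Y, X, Y] := h.rotate 2 (by simp)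
  have antiX : β [X, X, Y] + β [X, Y, X] = 0 := h.anticomm [X] (by simp)
  have antiY : β [Y, X, Y] + β [Y, Y, X] = 0 := h.anticomm [Y] (by simp)
  have circX : β [X, X, X] + β [X, Y, Y] = β [X] := h.circle [X] (by simp)
  have circY : β [Y, X, X] + β [Y, Y, Y] = β [Y] := h.circle [Y] (by simp)
  cases l₁ <;> cases l₂ <;> cases l₃ <;> simp only [circleValue] <;> linarith

theorem eq_circleValue_four (h : CircleRelations β) (l₁ l₂ l₃ l₄ : Letter) :
    β [l₁, l₂, l₃, l₄] =
      circleValue (β [X]) (β [Y]) (β [X, X]) (β [X, X, Y, Y]) [l₁, l₂, l₃, l₄] := by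
  have rotXXXY₁ : β [X, X, X, Y] = β [X, X, Y, X] := h.rotate 1 (by simp)
  have rotXXXY₂ : β [X, X, X, Y] = β [X, Y, X, X] := h.rotate 2 (by simp)
  have rotXXXY₃ : β [X, X, X, Y] = β [Y, X, X, X] := h.rotate 3 (by simp)
  have rotXYYY₁ : β [X, Y, Y, Y] = β [Y, Y, Y, X] := h.rotate 1 (by simp)
  have rotXYYY₂ : β [X, Y, Y, Y] = β [Y, Y, X, Y] := h.rotate 2 (by simp)
  have rotXYYY₃ : β [X, Y, Y, Y] = β [Y, X, Y, Y] := h.rotate 3 (by simp)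
  have rotXXYY₁ : β [X, X, Y, Y] = β [X, Y, Y, X] := h.rotate 1 (by simp)
  have rotXXYY₂ : β [X, X, Y, Y] = β [Y, Y, X, X] := h.rotate 2 (by simp)
  have rotXXYY₃ : β [X, X, Y, Y] = β [Y, X, X, Y] := h.rotate 3 (by simp)
  have rotXYXY : β [X, Y, X, Y] = β [Y, X, Y, X] := h.rotate 1 (by simp)
  have antiXX : β [X, X, X, Y] + β [X, X, Y, X] = 0 := h.anticomm [X, X] (by simp)
  have antiYY : β [Y, Y, X, Y] + β [Y, Y, Y, X] = 0 := h.anticomm [Y, Y] (by simp)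
  have circYY : β [Y, Y, X, X] + β [Y, Y, Y, Y] = β [Y, Y] := h.circle [Y, Y] (by simp)
  have valXXXX := h.apply_XXXX
  have valXYXY := h.apply_XYXY
  have valYY := h.apply_YY
  cases l₁ <;> cases l₂ <;> cases l₃ <;> cases l₄ <;> simp only [circleValue] <;> linarith

theorem eq_circleValue (h : CircleRelations β) {w : Word} (hw : w.length ≤ 4) :
    β w = circleValue (β [X]) (β [Y]) (β [X, X]) (β [X, X, Y, Y]) w := by
  match w, hw with
  | [], _ => exact h.one
  | [X], _ => rfl
  | [Y], _ => rfl
  | [_, _], _ => exact h.eq_circleValue_two _ _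
  | [_, _, _], _ => exact h.eq_circleValue_three _ _ _
  | [_, _, _, _], _ => exact h.eq_circleValue_four _ _ _ _
  | _ :: _ :: _ :: _ :: _ :: _, hw => simp at hw; omega

theorem ext (hβ : CircleRelations β) (hγ : CircleRelations γ)
    (hX : β [X] = γ [X]) (hY : β [Y] = γ [Y]) (hXX : β [X, X] = γ [X, X])
    (hXXYY : β [X, X, Y, Y] = γ [X, X, Y, Y]) {w : Word} (hw : w.length ≤ 4) : β w = γ w := by
  rw [hβ.eq_circleValue hw, hγ.eq_circleValue hw, hX, hY, hXX, hXXYY]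

end CircleRelations

end CircleRelations

section EvalWord

variable {t : ℕ} (A B : Matrix (Fin t) (Fin t) ℝ)

@[simp] theorem evalWord_nil : evalWord A B [] = 1 := rfl

@[simp] theorem evalWord_cons_X (w : Word) : evalWord A B (X :: w) = A * evalWord A B w := rfl

@[simp] theorem evalWord_cons_Y (w : Word) : evalWord A B (Y :: w) = B * evalWord A B w := rfl

theorem evalWord_append (v w : Word) :
    evalWord A B (v ++ w) = evalWord A B v * evalWord A B w := by
  simp [evalWord]

variable {A B}

theorem evalWord_reverse (hA : A.IsSymm) (hB : B.IsSymm) (w : Word) :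
    evalWord A B w.reverse = (evalWord A B w)ᵀ := by
  induction w with
  | nil => simp
  | cons l w ih =>
    cases l <;> simp [evalWord_append, ih, hA.eq, hB.eq, transpose_mul]

end EvalWord

theorem trace_star_mul_self_nonneg {n : Type*} [Fintype n] (A : Matrix n n ℝ) :
    0 ≤ (star A * A).trace :=
  (posSemidef_conjTranspose_mul_self A).trace_nonneg

namespace AtomicMeasure

variable (μ : AtomicMeasure)

theorem isTracial_moment : IsTracial μ.moment := by
  constructor
  · rintro v w - ⟨n, rfl⟩
    refine Finset.sum_congr rfl fun i _ => ?_
    rw [List.rotate_eq_drop_append_take_mod, evalWord_append, trace_mul_comm, ← evalWord_append,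
      List.take_append_drop]
  · intro w _
    refine Finset.sum_congr rfl fun i _ => ?_
    rw [evalWord_reverse (μ.symmX i) (μ.symmY i), trace_transpose]

theorem moment_nil : μ.moment [] = 1 := by
  rw [moment, ← μ.sum_density]
  refine Finset.sum_congr rfl fun i _ => ?_
  have := μ.size_pos i
  simp [this.ne']

/-- The weighted trace `∑ᵢ λᵢ tr(·) / tᵢ` on the algebra `∏ᵢ M_{tᵢ}(ℝ)` that contains the atoms. -/
noncomputable def state : (∀ i, Matrix (Fin (μ.size i)) (Fin (μ.size i)) ℝ) →ₗ[ℝ] ℝ :=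
  ∑ i, (μ.density i * (μ.size i : ℝ)⁻¹) •
    (traceLinearMap (Fin (μ.size i)) ℝ ℝ ∘ₗ LinearMap.proj i)

theorem state_apply (c : ∀ i, Matrix (Fin (μ.size i)) (Fin (μ.size i)) ℝ) :
    μ.state c = ∑ i, μ.density i * (μ.size i : ℝ)⁻¹ * (c i).trace := by
  simp [state]

/-- The value of the word `w` in the algebra `∏ᵢ M_{tᵢ}(ℝ)`. -/
def eval (w : Word) : ∀ i, Matrix (Fin (μ.size i)) (Fin (μ.size i)) ℝ :=
  fun i => evalWord (μ.atomX i) (μ.atomY i) w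

@[simp] theorem eval_nil : μ.eval [] = 1 := rfl

@[simp] theorem eval_cons_X (w : Word) : μ.eval (X :: w) = μ.atomX * μ.eval w := rfl

@[simp] theorem eval_cons_Y (w : Word) : μ.eval (Y :: w) = μ.atomY * μ.eval w := rfl

theorem eval_append (v w : Word) : μ.eval (v ++ w) = μ.eval v * μ.eval w :=
  funext fun _ => evalWord_append _ _ v w

theorem moment_eq_state (w : Word) : μ.moment w = μ.state (μ.eval w) := by
  simp only [moment, state_apply, eval, mul_assoc]

theorem density_mul_inv_size_pos (i : Fin μ.N) : 0 < μ.density i * (μ.size i : ℝ)⁻¹ :=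
  mul_pos (μ.density_pos i) (inv_pos.2 (Nat.cast_pos.2 (μ.size_pos i)))

theorem isPositiveTrace_state : IsPositiveTrace μ.state where
  mul_comm a b := by
    simp only [state_apply, Pi.mul_apply]
    exact Finset.sum_congr rfl fun i _ => by rw [trace_mul_comm]
  nonneg a := by
    rw [state_apply]
    exact Finset.sum_nonneg fun i _ =>
      mul_nonneg (μ.density_mul_inv_size_pos i).le (trace_star_mul_self_nonneg (a i))

theorem eq_zero_of_state_star_mul_self_eq_zero
    {a : ∀ i, Matrix (Fin (μ.size i)) (Fin (μ.size i)) ℝ} (h : μ.state (star a * a) = 0) :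
    a = 0 := by
  have hterm (i : Fin μ.N) :
      0 ≤ μ.density i * (μ.size i : ℝ)⁻¹ * ((star a * a) i).trace :=
    mul_nonneg (μ.density_mul_inv_size_pos i).le (trace_star_mul_self_nonneg (a i))
  rw [state_apply, Finset.sum_eq_zero_iff_of_nonneg fun i _ => hterm i] at h
  funext i
  have htrace := (mul_eq_zero.1 (h i (Finset.mem_univ i))).resolve_left
    (μ.density_mul_inv_size_pos i).ne'
  exact trace_conjTranspose_mul_self_eq_zero_iff.1 htrace

theorem isSelfAdjoint_atomX : IsSelfAdjoint μ.atomX :=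
  funext fun i => (conjTranspose_eq_transpose_of_trivial _).trans (μ.symmX i)

theorem isSelfAdjoint_atomY : IsSelfAdjoint μ.atomY :=
  funext fun i => (conjTranspose_eq_transpose_of_trivial _).trans (μ.symmY i)

variable {μ} {β : Word → ℝ}

theorem Represents.anticomm (hμ : μ.Represents β) (hβ : CircleRelations β) :
    μ.atomX * μ.atomY + μ.atomY * μ.atomX = 0 := by
  refine μ.eq_zero_of_state_star_mul_self_eq_zero ?_
  have hself : star (μ.atomX * μ.atomY + μ.atomY * μ.atomX) =
      μ.atomX * μ.atomY + μ.atomY * μ.atomX := by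
    rw [star_add, star_mul, star_mul, μ.isSelfAdjoint_atomX.star_eq,
      μ.isSelfAdjoint_atomY.star_eq, add_comm]
  have hexpand : (μ.atomX * μ.atomY + μ.atomY * μ.atomX) *
      (μ.atomX * μ.atomY + μ.atomY * μ.atomX) =
      μ.eval [X, Y, X, Y] + μ.eval [X, Y, Y, X] +
        (μ.eval [Y, X, X, Y] + μ.eval [Y, X, Y, X]) := by
    simp only [eval_cons_X, eval_cons_Y, eval_nil]
    noncomm_ring
  rw [hself, hexpand]
  simp only [map_add, ← moment_eq_state]
  rw [← hμ _ (by simp), ← hμ _ (by simp), ← hμ _ (by simp), ← hμ _ (by simp)]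
  have hXY : β [X, Y, X, Y] + β [X, Y, Y, X] = 0 := hβ.anticomm [X, Y] (by simp)
  have hYX : β [Y, X, X, Y] + β [Y, X, Y, X] = 0 := hβ.anticomm [Y, X] (by simp)
  rw [hXY, hYX, add_zero]

theorem Represents.sq_add_sq (hμ : μ.Represents β) (hβ : CircleRelations β) :
    μ.atomX ^ 2 + μ.atomY ^ 2 = 1 := by
  refine sub_eq_zero.1 (μ.eq_zero_of_state_star_mul_self_eq_zero ?_)
  have hself : IsSelfAdjoint (μ.atomX ^ 2 + μ.atomY ^ 2 - 1) :=
    ((μ.isSelfAdjoint_atomX.pow 2).add (μ.isSelfAdjoint_atomY.pow 2)).sub (IsSelfAdjoint.one _)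
  have hexpand : (μ.atomX ^ 2 + μ.atomY ^ 2 - 1) * (μ.atomX ^ 2 + μ.atomY ^ 2 - 1) =
      (μ.eval [X, X, X, X] + μ.eval [X, X, Y, Y] - μ.eval [X, X]) +
        (μ.eval [Y, Y, X, X] + μ.eval [Y, Y, Y, Y] - μ.eval [Y, Y]) -
          (μ.eval [X, X] + μ.eval [Y, Y] - μ.eval []) := by
    simp only [eval_cons_X, eval_cons_Y, eval_nil]
    noncomm_ring
  rw [hself.star_eq, hexpand]
  simp only [map_add, map_sub, ← moment_eq_state]
  rw [← hμ _ (by simp), ← hμ _ (by simp), ← hμ _ (by simp), ← hμ _ (by simp), ← hμ _ (by simp),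
    ← hμ _ (by simp), ← hμ _ (by simp)]
  have hXX : β [X, X, X, X] + β [X, X, Y, Y] = β [X, X] := hβ.circle [X, X] (by simp)
  have hYY : β [Y, Y, X, X] + β [Y, Y, Y, Y] = β [Y, Y] := hβ.circle [Y, Y] (by simp)
  have hone : β [X, X] + β [Y, Y] = β [] := hβ.circle [] (by simp)
  linarith

theorem Represents.isCirclePair (hμ : μ.Represents β) (hβ : CircleRelations β) :
    IsCirclePair μ.atomX μ.atomY :=
  ⟨μ.isSelfAdjoint_atomX, μ.isSelfAdjoint_atomY, hμ.anticomm hβ, hμ.sq_add_sq hβ⟩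

theorem circleRelations_moment (h : IsCirclePair μ.atomX μ.atomY) :
    CircleRelations μ.moment where
  tracial := μ.isTracial_moment
  one := μ.moment_nil
  anticomm r _ := by
    have hword : μ.eval (r ++ [X, Y]) + μ.eval (r ++ [Y, X]) = 0 := by
      simp only [eval_append, eval_cons_X, eval_cons_Y, eval_nil, mul_one, ← mul_add, h.anticomm,
        mul_zero]
    rw [moment_eq_state, moment_eq_state, ← map_add, hword, map_zero]
  circle r _ := by
    have hword : μ.eval (r ++ [X, X]) + μ.eval (r ++ [Y, Y]) = μ.eval r := by
      simp only [eval_append, eval_cons_X, eval_cons_Y, eval_nil, mul_one, ← mul_add, ← sq,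
        h.sq_add_sq]
    rw [moment_eq_state, moment_eq_state, ← map_add, hword, moment_eq_state]

theorem Represents.state_sq_mul_sq (hμ : μ.Represents β) :
    μ.state (μ.atomX ^ 2 * μ.atomY ^ 2) = β [X, X, Y, Y] := by
  rw [hμ _ (by simp), moment_eq_state]
  simp only [eval_cons_X, eval_cons_Y, eval_nil, mul_one, sq, mul_assoc]

theorem Represents.apply_XXYY_nonneg (hμ : μ.Represents β) (hβ : CircleRelations β) :
    0 ≤ β [X, X, Y, Y] :=
  hμ.state_sq_mul_sq ▸ (hμ.isCirclePair hβ).trace_sq_mul_sq_nonneg μ.isPositiveTrace_state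

theorem Represents.apply_XXYY_le (hμ : μ.Represents β) (hβ : CircleRelations β) (t : ℝ) :
    β [X, X, Y, Y] ≤ (1 - t) ^ 2 * (β [X, X] - |β [X]|) + t ^ 2 * (β [Y, Y] - |β [Y]|) := by
  have key := (hμ.isCirclePair hβ).weighted_abs_trace_le μ.isPositiveTrace_state t
  rw [hμ.state_sq_mul_sq] at key
  simpa only [hμ [X] (by simp), hμ [Y] (by simp), hμ [X, X] (by simp), hμ [Y, Y] (by simp),
    moment_eq_state, eval_cons_X, eval_cons_Y, eval_nil, mul_one, sq] using key

end AtomicMeasure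

section Irreducible

/-- The `X`-part of the standard irreducible pair: for `0 < s < 1`, every irreducible circle pair of
size two with `X² = s` is orthogonally conjugate to `(irreducibleX s, irreducibleY s)`. -/
noncomputable def irreducibleX (s : ℝ) : Matrix (Fin 2) (Fin 2) ℝ := !![√s, 0; 0, -√s]

/-- The `Y`-part of the standard irreducible pair. -/
noncomputable def irreducibleY (s : ℝ) : Matrix (Fin 2) (Fin 2) ℝ :=
  !![0, √(1 - s); √(1 - s), 0]

theorem irreducibleX_mul_self {s : ℝ} (h₀ : 0 ≤ s) :
    irreducibleX s * irreducibleX s = diagonal fun _ => s := by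
  ext i j
  fin_cases i <;> fin_cases j <;> simp [irreducibleX, Real.mul_self_sqrt h₀]

theorem irreducibleY_mul_self {s : ℝ} (h₁ : s ≤ 1) :
    irreducibleY s * irreducibleY s = diagonal fun _ => 1 - s := by
  ext i j
  fin_cases i <;> fin_cases j <;> simp [irreducibleY, Real.mul_self_sqrt (sub_nonneg.2 h₁)]

theorem isCirclePair_irreducible {s : ℝ} (h₀ : 0 ≤ s) (h₁ : s ≤ 1) :
    IsCirclePair (irreducibleX s) (irreducibleY s) where
  selfAdjoint_left := by
    ext i j; fin_cases i <;> fin_cases j <;> simp [irreducibleX]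
  selfAdjoint_right := by
    ext i j; fin_cases i <;> fin_cases j <;> simp [irreducibleY]
  anticomm := by
    ext i j; fin_cases i <;> fin_cases j <;> simp [irreducibleX, irreducibleY, mul_comm]
  sq_add_sq := by
    simp [sq, irreducibleX_mul_self h₀, irreducibleY_mul_self h₁, diagonal_add]

theorem eq_zero_of_mulVec_eigenvectorBasis {n : Type*} [Fintype n] [DecidableEq n]
    {A : Matrix n n ℝ} (hA : A.IsHermitian) {C : Matrix n n ℝ}
    (h : ∀ j, C *ᵥ ⇑(hA.eigenvectorBasis j) = 0) : C = 0 := by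
  refine (map_eq_zero_iff _ toEuclideanLin.injective).1
    (hA.eigenvectorBasis.toBasis.ext fun j => ?_)
  rw [OrthonormalBasis.coe_toBasis, toLpLin_apply, h j]
  rfl

theorem dotProduct_mulVec_of_isSelfAdjoint {n : Type*} [Fintype n] {A : Matrix n n ℝ}
    (hA : IsSelfAdjoint A) (v w : n → ℝ) : (A *ᵥ v) ⬝ᵥ w = v ⬝ᵥ (A *ᵥ w) := by
  have hsymm : Aᵀ = A := (conjTranspose_eq_transpose_of_trivial A).symm.trans hA
  rw [dotProduct_mulVec, ← mulVec_transpose, hsymm]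

theorem exists_intertwining_of_eigenvectors {n : Type*} [Fintype n] {A B : Matrix n n ℝ}
    (hA : IsSelfAdjoint A) {s : ℝ} (hs : 0 < s) {v w : n → ℝ} (hv : v ⬝ᵥ v = 1) (hw : w ⬝ᵥ w = 1)
    (hAv : A *ᵥ v = √s • v) (hAw : A *ᵥ w = -√s • w)
    (hBv : B *ᵥ v = √(1 - s) • w) (hBw : B *ᵥ w = √(1 - s) • v) :
    ∃ U : Matrix n (Fin 2) ℝ,
      Uᵀ * U = 1 ∧ A * U = U * irreducibleX s ∧ B * U = U * irreducibleY s := by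
  have hvw : v ⬝ᵥ w = 0 := by
    have hself : (A *ᵥ v) ⬝ᵥ w = v ⬝ᵥ (A *ᵥ w) := dotProduct_mulVec_of_isSelfAdjoint hA v w
    rw [hAv, hAw, smul_dotProduct, dotProduct_smul, smul_eq_mul, smul_eq_mul] at hself
    have hsqrt := Real.sqrt_pos.2 hs
    nlinarith
  have hmul (C : Matrix n n ℝ) : C * (of ![v, w])ᵀ = (of ![C *ᵥ v, C *ᵥ w])ᵀ := by
    ext i j
    fin_cases j <;> rfl
  refine ⟨(of ![v, w])ᵀ, ?_, ?_, ?_⟩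
  · ext i j
    fin_cases i <;> fin_cases j
    · exact hv
    · exact hvw
    · exact (dotProduct_comm w v).trans hvw
    · exact hw
  · rw [hmul, hAv, hAw]
    ext i j
    fin_cases j <;> simp [irreducibleX, mul_apply, mul_comm]
  · rw [hmul, hBv, hBw]
    ext i j
    fin_cases j <;> simp [irreducibleY, mul_apply, mul_comm]

namespace IsCirclePair

variable {n : Type*} [Fintype n] [DecidableEq n] {A B : Matrix n n ℝ}

theorem exists_unit_eigenvector (h : IsCirclePair A B) (hAB : A * B ≠ 0) :
    ∃ (r : ℝ) (v : n → ℝ), r ≠ 0 ∧ A *ᵥ v = r • v ∧ v ⬝ᵥ v = 1 ∧ B *ᵥ v ≠ 0 := by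
  have hA : A.IsHermitian := h.selfAdjoint_left
  obtain ⟨j, hj⟩ : ∃ j, (B * A) *ᵥ ⇑(hA.eigenvectorBasis j) ≠ 0 := by
    by_contra! hzero
    exact hAB (by rw [h.mul_eq_neg, eq_zero_of_mulVec_eigenvectorBasis hA hzero, neg_zero])
  rw [← mulVec_mulVec, hA.mulVec_eigenvectorBasis, mulVec_smul] at hj
  have hnorm : ⇑(hA.eigenvectorBasis j) ⬝ᵥ ⇑(hA.eigenvectorBasis j) = 1 := by
    have hinner := real_inner_self_eq_norm_sq (hA.eigenvectorBasis j)
    rwa [hA.eigenvectorBasis.norm_eq_one, one_pow] at hinner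
  exact ⟨_, _, left_ne_zero_of_smul hj, hA.mulVec_eigenvectorBasis j, hnorm,
    right_ne_zero_of_smul hj⟩

theorem mulVec_right_mulVec_right (h : IsCirclePair A B) {r : ℝ} {v : n → ℝ}
    (hv : A *ᵥ v = r • v) : B *ᵥ (B *ᵥ v) = (1 - r ^ 2) • v := by
  rw [mulVec_mulVec, ← sq, eq_sub_of_add_eq' h.sq_add_sq, sub_mulVec, one_mulVec, sq,
    ← mulVec_mulVec, hv, mulVec_smul, hv, smul_smul, sub_smul, one_smul, sq]

theorem mulVec_left_mulVec_right (h : IsCirclePair A B) {r : ℝ} {v : n → ℝ}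
    (hv : A *ᵥ v = r • v) : A *ᵥ (B *ᵥ v) = -r • (B *ᵥ v) := by
  rw [mulVec_mulVec, h.mul_eq_neg, neg_mulVec, ← mulVec_mulVec, hv, mulVec_smul, neg_smul]

theorem exists_irreducible_subpair (h : IsCirclePair A B) (hAB : A * B ≠ 0) :
    ∃ s : ℝ, 0 < s ∧ s < 1 ∧ ∃ U : Matrix n (Fin 2) ℝ,
      Uᵀ * U = 1 ∧ A * U = U * irreducibleX s ∧ B * U = U * irreducibleY s := by
  obtain ⟨r, v, hr, hAv, hv, hBv⟩ := h.exists_unit_eigenvector hAB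
  have hnorm : (B *ᵥ v) ⬝ᵥ (B *ᵥ v) = 1 - r ^ 2 := by
    rw [dotProduct_mulVec_of_isSelfAdjoint h.selfAdjoint_right, h.mulVec_right_mulVec_right hAv,
      dotProduct_smul, hv, smul_eq_mul, mul_one]
  have hpos : 0 < 1 - r ^ 2 := hnorm ▸ dotProduct_self_star_pos_iff.2 hBv
  have hsqrt : √(1 - r ^ 2) ≠ 0 := (Real.sqrt_pos.2 hpos).ne'
  set w := (√(1 - r ^ 2))⁻¹ • (B *ᵥ v) with hw
  have hww : w ⬝ᵥ w = 1 := by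
    rw [hw, smul_dotProduct, dotProduct_smul, hnorm, smul_eq_mul, smul_eq_mul,
      inv_mul_eq_div, inv_mul_eq_div, Real.div_sqrt, div_self hsqrt]
  have hAw : A *ᵥ w = -r • w := by
    rw [hw, mulVec_smul, h.mulVec_left_mulVec_right hAv, smul_comm]
  have hBv' : B *ᵥ v = √(1 - r ^ 2) • w := (smul_inv_smul₀ hsqrt _).symm
  have hBw : B *ᵥ w = √(1 - r ^ 2) • v := by
    rw [hw, mulVec_smul, h.mulVec_right_mulVec_right hAv, smul_smul, inv_mul_eq_div, Real.div_sqrt]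
  refine ⟨r ^ 2, by positivity, by linarith, ?_⟩
  rcases lt_or_gt_of_ne hr with hneg | hgt
  · have hsq : √(r ^ 2) = -r := by rw [Real.sqrt_sq_eq_abs, abs_of_neg hneg]
    exact exists_intertwining_of_eigenvectors h.selfAdjoint_left (by positivity) hww hv
      (by rw [hsq, hAw]) (by rw [hsq, neg_neg, hAv]) hBw hBv'
  · have hsq : √(r ^ 2) = r := Real.sqrt_sq hgt.le
    exact exists_intertwining_of_eigenvectors h.selfAdjoint_left (by positivity) hv hww
      (by rw [hsq, hAv]) (by rw [hsq, hAw]) hBv' hBw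

end IsCirclePair

end Irreducible

section OrthConjugate

/-- The normalized trace of `w(A, B)`. -/
noncomputable def wordTrace {t : ℕ} (A B : Matrix (Fin t) (Fin t) ℝ) (w : Word) : ℝ :=
  (t : ℝ)⁻¹ * (evalWord A B w).trace

/-- The pairs `(A, B)` and `(A', B')` are conjugate by a common orthogonal matrix; the sizes are
kept distinct in the type because the size of an atom is only propositionally known. -/
def OrthConjugate {m n : ℕ} (A B : Matrix (Fin m) (Fin m) ℝ) (A' B' : Matrix (Fin n) (Fin n) ℝ) :
    Prop :=
  ∃ U : Matrix (Fin n) (Fin m) ℝ, U * Uᵀ = 1 ∧ Uᵀ * U = 1 ∧ A' = U * A * Uᵀ ∧ B' = U * B * Uᵀ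

namespace OrthConjugate

variable {l m n : ℕ} {A B : Matrix (Fin l) (Fin l) ℝ} {A' B' : Matrix (Fin m) (Fin m) ℝ}
  {A'' B'' : Matrix (Fin n) (Fin n) ℝ}

theorem refl (A B : Matrix (Fin l) (Fin l) ℝ) : OrthConjugate A B A B :=
  ⟨1, by simp⟩

theorem of_intertwining {U : Matrix (Fin l) (Fin l) ℝ} (hU : Uᵀ * U = 1)
    {C D : Matrix (Fin l) (Fin l) ℝ} (hA : C * U = U * A) (hB : D * U = U * B) :
    OrthConjugate A B C D := by
  have hU' : U * Uᵀ = 1 := mul_eq_one_comm.1 hU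
  exact ⟨U, hU', hU, by rw [← hA, Matrix.mul_assoc, hU', Matrix.mul_one],
    by rw [← hB, Matrix.mul_assoc, hU', Matrix.mul_one]⟩

theorem symm (h : OrthConjugate A B A' B') : OrthConjugate A' B' A B := by
  obtain ⟨U, hU, hU', rfl, rfl⟩ := h
  have hcancel (C : Matrix (Fin l) (Fin l) ℝ) : C = Uᵀ * (U * C * Uᵀ) * Uᵀᵀ := by
    rw [transpose_transpose, Matrix.mul_assoc, Matrix.mul_assoc, hU', Matrix.mul_one,
      ← Matrix.mul_assoc, hU', Matrix.one_mul]
  exact ⟨Uᵀ, by rwa [transpose_transpose], by rwa [transpose_transpose], hcancel A, hcancel B⟩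

theorem trans (h : OrthConjugate A B A' B') (h' : OrthConjugate A' B' A'' B'') :
    OrthConjugate A B A'' B'' := by
  obtain ⟨U, hU₁, hU₂, rfl, rfl⟩ := h
  obtain ⟨V, hV₁, hV₂, rfl, rfl⟩ := h'
  refine ⟨V * U, ?_, ?_, ?_, ?_⟩
  · rw [transpose_mul, Matrix.mul_assoc, ← Matrix.mul_assoc U, hU₁, Matrix.one_mul, hV₁]
  · rw [transpose_mul, Matrix.mul_assoc, ← Matrix.mul_assoc Vᵀ, hV₂, Matrix.one_mul, hU₂]
  all_goals simp only [transpose_mul, Matrix.mul_assoc]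

theorem size_eq (h : OrthConjugate A B A' B') : m = l := by
  obtain ⟨U, hU₁, hU₂, -, -⟩ := h
  have htrace : ((U * Uᵀ).trace : ℝ) = (Uᵀ * U).trace := trace_mul_comm _ _
  rw [hU₁, hU₂, trace_one, trace_one, Fintype.card_fin, Fintype.card_fin] at htrace
  exact_mod_cast htrace

theorem wordTrace_eq (h : OrthConjugate A B A' B') (w : Word) :
    wordTrace A' B' w = wordTrace A B w := by
  obtain rfl := h.size_eq
  rw [wordTrace, wordTrace]
  obtain ⟨U, hU₁, hU₂, rfl, rfl⟩ := h
  have hconj : evalWord (U * A * Uᵀ) (U * B * Uᵀ) w = U * evalWord A B w * Uᵀ := by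
    have hcancel (C D : Matrix (Fin m) (Fin m) ℝ) :
        U * C * Uᵀ * (U * D * Uᵀ) = U * (C * D) * Uᵀ := by
      rw [Matrix.mul_assoc (U * C), ← Matrix.mul_assoc Uᵀ, ← Matrix.mul_assoc Uᵀ, hU₂,
        Matrix.one_mul, ← Matrix.mul_assoc, Matrix.mul_assoc U]
    induction w with
    | nil => rw [evalWord_nil, evalWord_nil, Matrix.mul_one, hU₁]
    | cons x w ih => cases x <;> simp only [evalWord_cons_X, evalWord_cons_Y, ih, hcancel]
  rw [hconj, Matrix.mul_assoc, trace_mul_comm, Matrix.mul_assoc, hU₂, Matrix.mul_one]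

end OrthConjugate

theorem IsCirclePair.exists_orthConjugate_irreducible {n : ℕ} (hn : n = 2)
    {A B : Matrix (Fin n) (Fin n) ℝ} (h : IsCirclePair A B) (hAB : A * B ≠ 0) :
    ∃ s : ℝ, 0 < s ∧ s < 1 ∧ OrthConjugate (irreducibleX s) (irreducibleY s) A B := by
  subst hn
  obtain ⟨s, hs₀, hs₁, U, hU, hA, hB⟩ := h.exists_irreducible_subpair hAB
  exact ⟨s, hs₀, hs₁, .of_intertwining hU hA hB⟩

end OrthConjugate

namespace AtomicMeasure

section MaxSize

variable {μ ν : AtomicMeasure}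

theorem size_le_maxSize (i : Fin μ.N) : μ.size i ≤ μ.maxSize :=
  Finset.le_sup (f := μ.size) (Finset.mem_univ i)

theorem atomCount_zero (μ : AtomicMeasure) : μ.atomCount 0 = 0 :=
  Finset.card_eq_zero.2 (Finset.filter_eq_empty_iff.2 fun i _ => (μ.size_pos i).ne')

theorem atomCount_eq_zero_of_maxSize_lt {n : ℕ} (h : μ.maxSize < n) : μ.atomCount n = 0 :=
  Finset.card_eq_zero.2 (Finset.filter_eq_empty_iff.2 fun i _ =>
    ((size_le_maxSize i).trans_lt h).ne)

theorem atomCount_maxSize_pos (μ : AtomicMeasure) : 0 < μ.atomCount μ.maxSize := by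
  have hne : (Finset.univ : Finset (Fin μ.N)).Nonempty :=
    Finset.nonempty_of_sum_ne_zero (μ.sum_density.trans_ne one_ne_zero)
  obtain ⟨i, -, hi⟩ := Finset.exists_mem_eq_sup _ hne μ.size
  exact Finset.card_pos.2 ⟨i, (Finset.mem_filter_univ i).2 hi.symm⟩

theorem type_eq_of_maxSize_eq_two (h : μ.maxSize = 2) :
    μ.type = [μ.atomCount 1, μ.atomCount 2] := by
  rw [type, h]
  rfl

theorem smallerType_iff_of_maxSize_eq_two (hμ : μ.maxSize = 2) (hν : ν.maxSize = 2) :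
    ν.SmallerType μ ↔ ν.atomCount 2 < μ.atomCount 2 ∨
      ν.atomCount 2 = μ.atomCount 2 ∧ ν.atomCount 1 < μ.atomCount 1 := by
  have hzero {κ : AtomicMeasure} (hκ : κ.maxSize = 2) {n : ℕ} (hn : 2 < n) : κ.atomCount n = 0 :=
    atomCount_eq_zero_of_maxSize_lt (hκ.trans_lt hn)
  simp only [SmallerType, hμ, hν, lt_self_iff_false, false_or, true_and]
  constructor
  · rintro ⟨n, hlt, hgt⟩
    obtain rfl | rfl | rfl | hn : n = 0 ∨ n = 1 ∨ n = 2 ∨ 2 < n := by omega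
    · exact absurd (ν.atomCount_zero ▸ μ.atomCount_zero ▸ hlt) (lt_irrefl 0)
    · exact .inr ⟨hgt 2 one_lt_two, hlt⟩
    · exact .inl hlt
    · exact absurd (hzero hμ hn ▸ hlt) (Nat.not_lt_zero _)
  · rintro (hlt | ⟨heq, hlt⟩)
    · exact ⟨2, hlt, fun n hn => (hzero hν hn).trans (hzero hμ hn).symm⟩
    · refine ⟨1, hlt, fun n hn => ?_⟩
      obtain rfl | hn : n = 2 ∨ 2 < n := by omega
      · exact heq
      · exact (hzero hν hn).trans (hzero hμ hn).symm

end MaxSize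

namespace OrthEquiv

variable {μ ν κ : AtomicMeasure}

theorem symm (h : μ.OrthEquiv ν) : ν.OrthEquiv μ := by
  obtain ⟨σ, hσ⟩ := h
  refine ⟨σ.symm, fun j => ?_⟩
  obtain ⟨i, rfl⟩ := σ.surjective j
  rw [σ.symm_apply_apply]
  exact ⟨(hσ i).1.symm, OrthConjugate.symm (hσ i).2⟩

theorem trans (h : μ.OrthEquiv ν) (h' : ν.OrthEquiv κ) : μ.OrthEquiv κ := by
  obtain ⟨σ, hσ⟩ := h
  obtain ⟨τ, hτ⟩ := h'
  exact ⟨σ.trans τ, fun i => ⟨(hσ i).1.trans (hτ (σ i)).1,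
    OrthConjugate.trans (hσ i).2 (hτ (σ i)).2⟩⟩

theorem atomCount_eq (h : μ.OrthEquiv ν) (n : ℕ) : μ.atomCount n = ν.atomCount n := by
  obtain ⟨σ, hσ⟩ := h
  refine Finset.card_equiv σ fun i => ?_
  simp only [Finset.mem_filter_univ, OrthConjugate.size_eq (hσ i).2]

theorem maxSize_eq (h : μ.OrthEquiv ν) : μ.maxSize = ν.maxSize := by
  obtain ⟨σ, hσ⟩ := h
  rw [maxSize, maxSize, ← Finset.map_univ_equiv σ, Finset.sup_map]
  exact Finset.sup_congr rfl fun i _ => (OrthConjugate.size_eq (hσ i).2).symm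

theorem type_eq (h : μ.OrthEquiv ν) : μ.type = ν.type := by
  simp only [type, h.maxSize_eq, h.atomCount_eq]

end OrthEquiv

end AtomicMeasure

/-- A family of pairs of symmetric matrices, the possible atoms of a measure up to orthogonal
conjugation. -/
structure AtomFamily (κ : Type*) where
  size : κ → ℕ
  size_pos : ∀ c, 0 < size c
  atomX : ∀ c, Matrix (Fin (size c)) (Fin (size c)) ℝ
  atomY : ∀ c, Matrix (Fin (size c)) (Fin (size c)) ℝ
  symmX : ∀ c, (atomX c).IsSymm
  symmY : ∀ c, (atomY c).IsSymm

namespace AtomicMeasure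

variable {κ : Type*} [DecidableEq κ] {ν : AtomicMeasure}

/-- The total density of the atoms of `ν` that carry the label `c`. -/
noncomputable def labelWeight (ν : AtomicMeasure) (ℓ : Fin ν.N → κ) (c : κ) : ℝ :=
  ∑ i with ℓ i = c, ν.density i

theorem labelWeight_nonneg (ℓ : Fin ν.N → κ) (c : κ) : 0 ≤ ν.labelWeight ℓ c :=
  Finset.sum_nonneg fun i _ => (ν.density_pos i).le

theorem labelWeight_pos_iff {ℓ : Fin ν.N → κ} {c : κ} :
    0 < ν.labelWeight ℓ c ↔ ∃ i, ℓ i = c := by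
  rw [labelWeight, Finset.sum_pos_iff_of_nonneg fun i _ => (ν.density_pos i).le]
  exact ⟨fun ⟨i, hi, _⟩ => ⟨i, (Finset.mem_filter_univ i).1 hi⟩,
    fun ⟨i, hi⟩ => ⟨i, (Finset.mem_filter_univ i).2 hi, ν.density_pos i⟩⟩

theorem labelWeight_apply_of_injective {ℓ : Fin ν.N → κ} (hℓ : ℓ.Injective) (i : Fin ν.N) :
    ν.labelWeight ℓ (ℓ i) = ν.density i := by
  simp only [labelWeight, hℓ.eq_iff, Finset.filter_eq', Finset.mem_univ, if_true,
    Finset.sum_singleton]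

theorem sum_labelWeight_mul [Fintype κ] (ℓ : Fin ν.N → κ) (g : κ → ℝ) :
    ∑ c, ν.labelWeight ℓ c * g c = ∑ i, ν.density i * g (ℓ i) := by
  rw [← Finset.sum_fiberwise _ ℓ]
  refine Finset.sum_congr rfl fun c _ => ?_
  rw [labelWeight, Finset.sum_mul]
  exact Finset.sum_congr rfl fun i hi => by rw [(Finset.mem_filter.1 hi).2]

end AtomicMeasure

namespace AtomFamily

open AtomicMeasure

variable {κ : Type*} {F : AtomFamily κ} {μ ν : AtomicMeasure}

/-- The atom of `ν` with index `i` is orthogonally conjugate to the member `ℓ i` of the family. -/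
def IsLabelling (F : AtomFamily κ) (ν : AtomicMeasure) (ℓ : Fin ν.N → κ) : Prop :=
  ∀ i, OrthConjugate (F.atomX (ℓ i)) (F.atomY (ℓ i)) (ν.atomX i) (ν.atomY i)

namespace IsLabelling

theorem size_eq {ℓ : Fin ν.N → κ} (h : F.IsLabelling ν ℓ) (i : Fin ν.N) :
    ν.size i = F.size (ℓ i) :=
  (h i).size_eq

variable [DecidableEq κ]

theorem sum_labelWeight_mul_wordTrace [Fintype κ] {ℓ : Fin ν.N → κ} (h : F.IsLabelling ν ℓ)
    (w : Word) :
    ∑ c, ν.labelWeight ℓ c * wordTrace (F.atomX c) (F.atomY c) w = ν.moment w := by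
  rw [sum_labelWeight_mul]
  exact Finset.sum_congr rfl fun i _ => congrArg _ ((h i).wordTrace_eq w).symm

theorem image_label [Fintype κ] {ℓ : Fin ν.N → κ} (h : F.IsLabelling ν ℓ) (n : ℕ) :
    (Finset.univ.filter fun i => ν.size i = n).image ℓ =
      Finset.univ.filter fun c => 0 < ν.labelWeight ℓ c ∧ F.size c = n := by
  ext c
  simp only [Finset.mem_image, Finset.mem_filter_univ, labelWeight_pos_iff, h.size_eq]
  exact ⟨fun ⟨i, hi, hc⟩ => ⟨⟨i, hc⟩, hc ▸ hi⟩, fun ⟨⟨i, hc⟩, hn⟩ => ⟨i, hc ▸ hn, hc⟩⟩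

theorem card_label_le_atomCount [Fintype κ] {ℓ : Fin ν.N → κ} (h : F.IsLabelling ν ℓ) (n : ℕ) :
    (Finset.univ.filter fun c => 0 < ν.labelWeight ℓ c ∧ F.size c = n).card ≤ ν.atomCount n :=
  h.image_label n ▸ Finset.card_image_le

theorem card_label_of_injective [Fintype κ] {ℓ : Fin ν.N → κ} (h : F.IsLabelling ν ℓ)
    (hℓ : ℓ.Injective) (n : ℕ) :
    (Finset.univ.filter fun c => 0 < ν.labelWeight ℓ c ∧ F.size c = n).card = ν.atomCount n :=
  h.image_label n ▸ Finset.card_image_of_injective _ hℓ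

theorem injective_of_card_label [Fintype κ] {ℓ : Fin ν.N → κ} (h : F.IsLabelling ν ℓ)
    (hcard : ∀ i, (Finset.univ.filter fun c =>
      0 < ν.labelWeight ℓ c ∧ F.size c = ν.size i).card = ν.atomCount (ν.size i)) :
    ℓ.Injective := by
  intro i j hij
  have hinj := Finset.card_image_iff.1 ((congrArg _ (h.image_label (ν.size i))).trans (hcard i))
  refine hinj ?_ ?_ hij
  · simp
  · simp [h.size_eq, hij]

theorem orthEquiv {ℓ : Fin μ.N → κ} {ℓ' : Fin ν.N → κ} (h : F.IsLabelling μ ℓ)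
    (h' : F.IsLabelling ν ℓ') (hℓ : ℓ.Injective) (hℓ' : ℓ'.Injective)
    (hweight : μ.labelWeight ℓ = ν.labelWeight ℓ') : μ.OrthEquiv ν := by
  have hrange : Set.range ℓ = Set.range ℓ' := by
    ext c
    rw [Set.mem_range, Set.mem_range, ← labelWeight_pos_iff, ← labelWeight_pos_iff, hweight]
  let σ : Fin μ.N ≃ Fin ν.N := (Equiv.ofInjective ℓ hℓ).trans
    ((Equiv.setCongr hrange).trans (Equiv.ofInjective ℓ' hℓ').symm)
  have hσ (i : Fin μ.N) : ℓ' (σ i) = ℓ i :=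
    Equiv.apply_ofInjective_symm hℓ' _
  refine ⟨σ, fun i => ⟨?_, ?_⟩⟩
  · rw [← labelWeight_apply_of_injective hℓ, ← labelWeight_apply_of_injective hℓ', hσ, hweight]
  · have hν := h' (σ i)
    rw [hσ] at hν
    exact (h i).symm.trans hν

end IsLabelling

section OfWeights

variable [Fintype κ] (F) {W : κ → ℝ} (h₀ : ∀ c, 0 ≤ W c) (hW : ∑ c, W c = 1)

/-- The measure that gives the atom `c` of the family the density `W c`; labels of weight zero are
dropped. -/
noncomputable def ofWeights : AtomicMeasure where
  N := Fintype.card {c // 0 < W c}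
  size i := F.size ((Fintype.equivFin {c // 0 < W c}).symm i)
  size_pos _ := F.size_pos _
  density i := W ((Fintype.equivFin {c // 0 < W c}).symm i)
  density_pos i := ((Fintype.equivFin {c // 0 < W c}).symm i).2
  sum_density := by
    rw [Equiv.sum_comp (Fintype.equivFin {c // 0 < W c}).symm fun c => W c, ← hW,
      ← Finset.sum_subtype (Finset.univ.filter fun c => 0 < W c) (by simp) W]
    exact Finset.sum_filter_of_ne fun c _ hc => (h₀ c).lt_of_ne' hc
  atomX _ := F.atomX _
  atomY _ := F.atomY _
  symmX _ := F.symmX _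
  symmY _ := F.symmY _

/-- The index in the family of an atom of `F.ofWeights`. -/
noncomputable def ofWeightsLabel (i : Fin (F.ofWeights h₀ hW).N) : κ :=
  (Fintype.equivFin {c // 0 < W c}).symm i

theorem isLabelling_ofWeights : F.IsLabelling (F.ofWeights h₀ hW) (F.ofWeightsLabel h₀ hW) :=
  fun _ => .refl _ _

theorem ofWeightsLabel_injective : (F.ofWeightsLabel h₀ hW).Injective :=
  Subtype.val_injective.comp (Equiv.injective _)

theorem exists_atom_ofWeights (i : Fin (F.ofWeights h₀ hW).N) :
    ∃ c, (F.ofWeights h₀ hW).size i = F.size c ∧ (F.ofWeights h₀ hW).density i = W c ∧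
      ∀ w, wordTrace ((F.ofWeights h₀ hW).atomX i) ((F.ofWeights h₀ hW).atomY i) w =
        wordTrace (F.atomX c) (F.atomY c) w :=
  ⟨F.ofWeightsLabel h₀ hW i, rfl, rfl, fun _ => rfl⟩

theorem labelWeight_ofWeights [DecidableEq κ] :
    (F.ofWeights h₀ hW).labelWeight (F.ofWeightsLabel h₀ hW) = W := by
  funext c
  by_cases hc : 0 < W c
  · let i : Fin (F.ofWeights h₀ hW).N := Fintype.equivFin {c // 0 < W c} ⟨c, hc⟩
    have hi : F.ofWeightsLabel h₀ hW i = c :=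
      congrArg Subtype.val ((Fintype.equivFin {c // 0 < W c}).symm_apply_apply ⟨c, hc⟩)
    have hdensity : (F.ofWeights h₀ hW).density i = W (F.ofWeightsLabel h₀ hW i) := rfl
    rw [← hi, labelWeight_apply_of_injective (F.ofWeightsLabel_injective h₀ hW), hdensity]
  · have hzero : ¬ 0 < (F.ofWeights h₀ hW).labelWeight (F.ofWeightsLabel h₀ hW) c := by
      rw [labelWeight_pos_iff]
      rintro ⟨i, rfl⟩
      exact hc ((Fintype.equivFin {c // 0 < W c}).symm i).2
    exact ((labelWeight_nonneg _ c).antisymm' (not_lt.1 hzero)).trans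
      ((h₀ c).antisymm (not_lt.1 hc))

theorem moment_ofWeights (w : Word) :
    (F.ofWeights h₀ hW).moment w = ∑ c, W c * wordTrace (F.atomX c) (F.atomY c) w := by
  classical
  rw [← (F.isLabelling_ofWeights h₀ hW).sum_labelWeight_mul_wordTrace, labelWeight_ofWeights]

theorem atomCount_ofWeights (n : ℕ) :
    (F.ofWeights h₀ hW).atomCount n =
      (Finset.univ.filter fun c => 0 < W c ∧ F.size c = n).card := by
  classical
  rw [← (F.isLabelling_ofWeights h₀ hW).card_label_of_injective
    (F.ofWeightsLabel_injective h₀ hW), labelWeight_ofWeights]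

end OfWeights

end AtomFamily

section CircleFamily

/-- The possible atoms of a measure of type `(m, 1)`: the irreducible pair with `X² = s`, labelled
`none`, and the points `(1, 0)`, `(-1, 0)`, `(0, 1)`, `(0, -1)`. -/
noncomputable def circleFamily (s : ℝ) : AtomFamily (Option (Fin 4)) where
  size c := c.elim 2 fun _ => 1
  size_pos c := by cases c <;> simp
  atomX
    | none => irreducibleX s
    | some j => diagonal fun _ => ![1, -1, 0, 0] j
  atomY
    | none => irreducibleY s
    | some j => diagonal fun _ => ![0, 0, 1, -1] j
  symmX
    | none => by ext i j; fin_cases i <;> fin_cases j <;> simp [irreducibleX]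
    | some _ => isSymm_diagonal _
  symmY
    | none => by ext i j; fin_cases i <;> fin_cases j <;> simp [irreducibleY]
    | some _ => isSymm_diagonal _

theorem isCirclePair_scalar {n : Type*} [Fintype n] [DecidableEq n] {x y : ℝ} (hxy : x * y = 0)
    (hsq : x ^ 2 + y ^ 2 = 1) :
    IsCirclePair (diagonal fun _ : n => x) (diagonal fun _ : n => y) where
  selfAdjoint_left := isHermitian_diagonal _
  selfAdjoint_right := isHermitian_diagonal _
  anticomm := by simp [diagonal_mul_diagonal, hxy, mul_comm y x]
  sq_add_sq := by simp [diagonal_pow, diagonal_add, Pi.pow_def, hsq]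

theorem isCirclePair_circleFamily {s : ℝ} (h₀ : 0 ≤ s) (h₁ : s ≤ 1) (c : Option (Fin 4)) :
    IsCirclePair ((circleFamily s).atomX c) ((circleFamily s).atomY c) := by
  cases c with
  | none => exact isCirclePair_irreducible h₀ h₁
  | some j => exact isCirclePair_scalar (by fin_cases j <;> simp) (by fin_cases j <;> simp)

theorem IsCirclePair.mul_eq_zero_of_subsingleton {n : Type*} [Fintype n] [DecidableEq n]
    [Subsingleton n] {A B : Matrix n n ℝ} (h : IsCirclePair A B) : A * B = 0 := by
  have hcomm : B * A = A * B := by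
    ext i j
    simp only [mul_apply]
    exact Finset.sum_congr rfl fun k _ => by
      rw [Subsingleton.elim i k, Subsingleton.elim j k, mul_comm]
  ext i j
  have hneg := congrFun (congrFun (h.mul_eq_neg.trans (congrArg Neg.neg hcomm)) i) j
  exact self_eq_neg.1 hneg

theorem exists_circle_point {x y : ℝ} (hxy : x * y = 0) (hsq : x ^ 2 + y ^ 2 = 1) :
    ∃ j : Fin 4, x = ![1, -1, 0, 0] j ∧ y = ![0, 0, 1, -1] j := by
  rcases mul_eq_zero.1 hxy with rfl | rfl
  · have hy : y = 1 ∨ y = -1 := by simpa using hsq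
    rcases hy with rfl | rfl
    · exact ⟨2, rfl, rfl⟩
    · exact ⟨3, rfl, rfl⟩
  · have hx : x = 1 ∨ x = -1 := by simpa using hsq
    rcases hx with rfl | rfl
    · exact ⟨0, rfl, rfl⟩
    · exact ⟨1, rfl, rfl⟩

theorem IsCirclePair.exists_orthConjugate_point {n : ℕ} (hn : n = 1)
    {A B : Matrix (Fin n) (Fin n) ℝ} (h : IsCirclePair A B) (s : ℝ) :
    ∃ j : Fin 4, OrthConjugate ((circleFamily s).atomX (some j)) ((circleFamily s).atomY (some j))
      A B := by
  subst hn
  have hscalar (C : Matrix (Fin 1) (Fin 1) ℝ) : C = diagonal fun _ => C 0 0 := by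
    ext i j
    simp [Subsingleton.elim i 0, Subsingleton.elim j 0]
  have hmul := congrFun (congrFun h.mul_eq_zero_of_subsingleton 0) 0
  have hsq := congrFun (congrFun h.sq_add_sq 0) 0
  obtain ⟨j, hA, hB⟩ := exists_circle_point (x := A 0 0) (y := B 0 0)
    (by simpa [mul_apply] using hmul) (by simpa [mul_apply, sq] using hsq)
  refine ⟨j, ?_⟩
  rw [hscalar A, hscalar B, hA, hB]
  exact .refl _ _

theorem sum_circleFamily (s : ℝ) (W : Option (Fin 4) → ℝ) (w : Word) :
    ∑ c, W c * wordTrace ((circleFamily s).atomX c) ((circleFamily s).atomY c) w =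
      W none * wordTrace (irreducibleX s) (irreducibleY s) w +
        ∑ j : Fin 4, W (some j) *
          wordTrace (diagonal fun _ : Fin 1 => (![1, -1, 0, 0] : Fin 4 → ℝ) j)
            (diagonal fun _ : Fin 1 => (![0, 0, 1, -1] : Fin 4 → ℝ) j) w :=
  Fintype.sum_option _

variable {s : ℝ} (W : Option (Fin 4) → ℝ)

theorem sum_circleFamily_X :
    ∑ c, W c * wordTrace ((circleFamily s).atomX c) ((circleFamily s).atomY c) [X] =
      W (some 0) - W (some 1) := by
  rw [sum_circleFamily, Fin.sum_univ_four]
  simp [wordTrace, irreducibleX, trace_fin_two, ← sub_eq_add_neg]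

theorem sum_circleFamily_Y :
    ∑ c, W c * wordTrace ((circleFamily s).atomX c) ((circleFamily s).atomY c) [Y] =
      W (some 2) - W (some 3) := by
  rw [sum_circleFamily, Fin.sum_univ_four]
  simp [wordTrace, irreducibleY, trace_fin_two, ← sub_eq_add_neg]

theorem sum_circleFamily_XX (h₀ : 0 ≤ s) :
    ∑ c, W c * wordTrace ((circleFamily s).atomX c) ((circleFamily s).atomY c) [X, X] =
      W none * s + W (some 0) + W (some 1) := by
  rw [sum_circleFamily, Fin.sum_univ_four]
  simp [wordTrace, irreducibleX_mul_self h₀, add_assoc]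

theorem sum_circleFamily_XXYY (h₀ : 0 ≤ s) (h₁ : s ≤ 1) :
    ∑ c, W c * wordTrace ((circleFamily s).atomX c) ((circleFamily s).atomY c) [X, X, Y, Y] =
      W none * (s * (1 - s)) := by
  have hword : wordTrace (irreducibleX s) (irreducibleY s) [X, X, Y, Y] = s * (1 - s) := by
    simp [wordTrace, irreducibleY_mul_self h₁, ← Matrix.mul_assoc, irreducibleX_mul_self h₀]
  rw [sum_circleFamily, Fin.sum_univ_four, hword]
  simp [wordTrace]

end CircleFamily

section HyperbolaArc

/-- The points of the hyperbola `x⁻¹ + y⁻¹ = d⁻¹` in the box `(0, R] × (0, S]`. The points of this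
arc parametrize the measures with one atom of size two whose other atoms have size one. -/
def hyperbolaArc (d R S : ℝ) : Set (ℝ × ℝ) :=
  {x | x.1 ∈ Set.Ioc 0 R ∧ x.2 ∈ Set.Ioc 0 S ∧ x.1 * x.2 = d * (x.1 + x.2)}

variable {d R S : ℝ} {x y : ℝ × ℝ}

theorem swap_mem_hyperbolaArc (hx : x ∈ hyperbolaArc d R S) : x.swap ∈ hyperbolaArc d S R :=
  ⟨hx.2.1, hx.1, by simpa [mul_comm, add_comm] using hx.2.2⟩

theorem pos_of_mem_hyperbolaArc (hx : x ∈ hyperbolaArc d R S) : 0 < d := by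
  obtain ⟨⟨hx₁, -⟩, ⟨hx₂, -⟩, hmul⟩ := hx
  exact pos_of_mul_pos_left (hmul ▸ mul_pos hx₁ hx₂) (add_pos hx₁ hx₂).le

theorem eq_of_mem_hyperbolaArc_of_fst_eq (hx : x ∈ hyperbolaArc d R S)
    (hy : y ∈ hyperbolaArc d R S) (h : x.1 = y.1) : x = y := by
  have hd := pos_of_mem_hyperbolaArc hx
  have hlt : d < x.1 := by
    have hmul : (x.1 - d) * x.2 = d * x.1 := by linear_combination hx.2.2
    exact sub_pos.1 (pos_of_mul_pos_left (hmul ▸ mul_pos hd hx.1.1) hx.2.1.1.le)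
  refine Prod.ext h (mul_left_cancel₀ (sub_pos.2 hlt).ne' ?_)
  linear_combination hx.2.2 - hy.2.2 + (d - y.2) * h

theorem eq_of_mem_hyperbolaArc_of_snd_eq (hx : x ∈ hyperbolaArc d R S)
    (hy : y ∈ hyperbolaArc d R S) (h : x.2 = y.2) : x = y :=
  Prod.swap_injective (eq_of_mem_hyperbolaArc_of_fst_eq (swap_mem_hyperbolaArc hx)
    (swap_mem_hyperbolaArc hy) h)

theorem mul_add_sub_of_mem_hyperbolaArc (hx : x ∈ hyperbolaArc d R S) :
    (R * S - d * (R + S)) * (x.1 + x.2) = R * x.1 * (S - x.2) + S * x.2 * (R - x.1) := by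
  linear_combination (R + S) * hx.2.2

theorem mul_add_le_of_mem_hyperbolaArc (hx : x ∈ hyperbolaArc d R S) :
    d * (R + S) ≤ R * S := by
  have hgap := mul_add_sub_of_mem_hyperbolaArc hx
  obtain ⟨⟨hx₁, hR⟩, ⟨hx₂, hS⟩, -⟩ := hx
  refine sub_nonneg.1 (nonneg_of_mul_nonneg_left (hgap ▸ ?_) (add_pos hx₁ hx₂))
  have := sub_nonneg.2 hR
  have := sub_nonneg.2 hS
  have := hx₁.trans_le hR
  have := hx₂.trans_le hS
  positivity

theorem eq_corner_of_mem_hyperbolaArc (hcorner : d * (R + S) = R * S)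
    (hx : x ∈ hyperbolaArc d R S) : x = (R, S) := by
  have hgap := mul_add_sub_of_mem_hyperbolaArc hx
  obtain ⟨⟨hx₁, hR⟩, ⟨hx₂, hS⟩, -⟩ := hx
  have hR₀ := hx₁.trans_le hR
  have hS₀ := hx₂.trans_le hS
  rw [hcorner, sub_self, zero_mul, eq_comm, add_eq_zero_iff_of_nonneg
    (mul_nonneg (mul_pos hR₀ hx₁).le (sub_nonneg.2 hS))
    (mul_nonneg (mul_pos hS₀ hx₂).le (sub_nonneg.2 hR))] at hgap
  have hx₂_eq := (mul_eq_zero.1 hgap.1).resolve_left (mul_pos hR₀ hx₁).ne'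
  have hx₁_eq := (mul_eq_zero.1 hgap.2).resolve_left (mul_pos hS₀ hx₂).ne'
  exact Prod.ext (sub_eq_zero.1 hx₁_eq).symm (sub_eq_zero.1 hx₂_eq).symm

section Endpoints

variable (hd : 0 < d) (hR : 0 < R) (hS : 0 < S) (h : d * (R + S) ≤ R * S)
include hd hR hS h

theorem fst_endpoint_mem_hyperbolaArc : (R, d * R / (R - d)) ∈ hyperbolaArc d R S := by
  have hRd : 0 < R - d := by
    have hmul : d * S < R * S := by linarith [mul_pos hd hR]
    exact sub_pos.2 (lt_of_mul_lt_mul_right hmul hS.le)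
  refine ⟨⟨hR, le_rfl⟩, ⟨by positivity, ?_⟩, ?_⟩
  · rw [div_le_iff₀ hRd]
    linarith
  · field_simp
    ring

theorem snd_endpoint_mem_hyperbolaArc : (d * S / (S - d), S) ∈ hyperbolaArc d R S :=
  swap_mem_hyperbolaArc (fst_endpoint_mem_hyperbolaArc hd hS hR (by linarith))

end Endpoints

theorem nonempty_hyperbolaArc_iff :
    (hyperbolaArc d R S).Nonempty ↔ 0 < d ∧ 0 < R ∧ 0 < S ∧ d * (R + S) ≤ R * S :=
  ⟨fun ⟨_, hx⟩ => ⟨pos_of_mem_hyperbolaArc hx, hx.1.1.trans_le hx.1.2,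
    hx.2.1.1.trans_le hx.2.1.2, mul_add_le_of_mem_hyperbolaArc hx⟩,
  fun ⟨hd, hR, hS, h⟩ => ⟨_, fst_endpoint_mem_hyperbolaArc hd hR hS h⟩⟩

theorem nonempty_hyperbolaArc_of_forall_le (hd : 0 < d)
    (h : ∀ t : ℝ, d ≤ (1 - t) ^ 2 * R + t ^ 2 * S) : (hyperbolaArc d R S).Nonempty := by
  have hR : d ≤ R := by simpa using h 0
  have hS : d ≤ S := by simpa using h 1
  have hR₀ : 0 < R := hd.trans_le hR
  have hS₀ : 0 < S := hd.trans_le hS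
  -- The right-hand side is minimal at `t = R / (R + S)`.
  have hmin : (1 - R / (R + S)) ^ 2 * R + (R / (R + S)) ^ 2 * S = R * S / (R + S) := by
    field_simp
    ring
  exact nonempty_hyperbolaArc_iff.2 ⟨hd, hR₀, hS₀,
    (le_div_iff₀ (add_pos hR₀ hS₀)).1 ((h _).trans_eq hmin)⟩

end HyperbolaArc

section Minimizers

variable {α : Type*} {f : α → ℕ} {s : Set α} {k k' c c' : ℕ}

/-- Over `s`, the function `f` attains its minimum `c` at exactly `k` points. -/
def HasMinimizers (f : α → ℕ) (s : Set α) (k c : ℕ) : Prop :=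
  {x ∈ s | IsMinOn f s x}.ncard = k ∧ ∀ x ∈ s, IsMinOn f s x → f x = c

theorem HasMinimizers.iff_eq (h : HasMinimizers f s k c) (hk : k ≠ 0) :
    HasMinimizers f s k' c' ↔ k = k' ∧ c = c' := by
  obtain ⟨x, hx, hmin⟩ := Set.nonempty_of_ncard_ne_zero (h.1.trans_ne hk)
  exact ⟨fun h' => ⟨h.1.symm.trans h'.1, (h.2 x hx hmin).symm.trans (h'.2 x hx hmin)⟩,
    fun ⟨hk, hc⟩ => hk ▸ hc ▸ h⟩

theorem hasMinimizers_of_forall_le (hle : ∀ x ∈ s, c ≤ f x) (hs : {x ∈ s | f x = c}.ncard = k)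
    (hk : k ≠ 0) : HasMinimizers f s k c := by
  obtain ⟨x₀, hx₀, hfx₀⟩ := Set.nonempty_of_ncard_ne_zero (hs.trans_ne hk)
  have hmin (x : α) (hx : x ∈ s) : IsMinOn f s x ↔ f x = c :=
    ⟨fun h => ((isMinOn_iff.1 h x₀ hx₀).trans_eq hfx₀).antisymm (hle x hx),
      fun h => isMinOn_iff.2 fun y hy => h.trans_le (hle y hy)⟩
  refine ⟨?_, fun x hx => (hmin x hx).1⟩
  rw [← hs]
  exact congrArg Set.ncard (Set.ext fun x => and_congr_right (hmin x))

end Minimizers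

section ArcMinimizers

/-- The number of summands of positive weight in the remainders `R - x.1` and `S - x.2`: a positive
remainder is spread over two points, a zero remainder in the first or second coordinate over `m` or
`n` points. -/
noncomputable def remainderCount (R S : ℝ) (m n : ℕ) (x : ℝ × ℝ) : ℕ :=
  (if x.1 = R then m else 2) + (if x.2 = S then n else 2)

variable {d R S : ℝ}

theorem hasMinimizers_of_corner (hR : 0 < R) (hS : 0 < S) (m n : ℕ)
    (hcorner : d * (R + S) = R * S) :
    HasMinimizers (remainderCount R S m n) (hyperbolaArc d R S) 1 (m + n) := by
  have harc : hyperbolaArc d R S = {(R, S)} :=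
    (Set.subset_singleton_iff.2 fun _ => eq_corner_of_mem_hyperbolaArc hcorner).antisymm
      (Set.singleton_subset_iff.2 ⟨⟨hR, le_rfl⟩, ⟨hS, le_rfl⟩, hcorner.symm⟩)
  have hcount : remainderCount R S m n (R, S) = m + n := by simp [remainderCount]
  refine hasMinimizers_of_forall_le ?_ ?_ one_ne_zero
  · simp [harc, hcount]
  · rw [Set.ncard_eq_one]
    exact ⟨(R, S), by ext x; rw [harc]; simp +contextual [hcount]⟩

theorem hasMinimizers_of_lt (hd : 0 < d) (hR : 0 < R) (hS : 0 < S) {m n : ℕ} (hm : m ≤ 1)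
    (hn : n ≤ 1) (h : d * (R + S) < R * S) :
    HasMinimizers (remainderCount R S m n) (hyperbolaArc d R S) (if m = n then 2 else 1)
      (2 + min m n) := by
  have hcorner (x) (hx : x ∈ hyperbolaArc d R S) : ¬ (x.1 = R ∧ x.2 = S) :=
    fun ⟨h₁, h₂⟩ => h.ne' (h₁ ▸ h₂ ▸ hx.2.2)
  have hp := fst_endpoint_mem_hyperbolaArc hd hR hS h.le
  have hq := snd_endpoint_mem_hyperbolaArc hd hR hS h.le
  set p : ℝ × ℝ := (R, d * R / (R - d))
  set q : ℝ × ℝ := (d * S / (S - d), S)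
  have hp_iff (x) (hx : x ∈ hyperbolaArc d R S) : x.1 = R ↔ x = p :=
    ⟨eq_of_mem_hyperbolaArc_of_fst_eq hx hp, congrArg Prod.fst⟩
  have hq_iff (x) (hx : x ∈ hyperbolaArc d R S) : x.2 = S ↔ x = q :=
    ⟨eq_of_mem_hyperbolaArc_of_snd_eq hx hq, congrArg Prod.snd⟩
  have hpq : p ≠ q := fun hpq => hcorner p hp ⟨rfl, (hq_iff p hp).2 hpq⟩
  have hcount (x) (hx : x ∈ hyperbolaArc d R S) : remainderCount R S m n x =
      if x = p then m + 2 else if x = q then 2 + n else 4 := by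
    rw [remainderCount, if_congr (hp_iff x hx) rfl rfl, if_congr (hq_iff x hx) rfl rfl]
    split_ifs <;> grind
  refine hasMinimizers_of_forall_le (fun x hx => ?_) ?_ (by split_ifs <;> simp)
  · rw [hcount x hx]
    grind
  · have hset (u : Set (ℝ × ℝ)) (hu : ∀ x, x ∈ u ↔ x = p ∧ m ≤ n ∨ x = q ∧ n ≤ m) :
        {x ∈ hyperbolaArc d R S | remainderCount R S m n x = 2 + min m n} = u := by
      ext x
      rw [hu]
      grind
    split_ifs with hmn
    · rw [hset {p, q} (by simp [hmn]), Set.ncard_pair hpq]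
    · rcases lt_or_gt_of_ne hmn with hlt | hlt
      · rw [hset {p} (by simp [hlt.le, hlt]), Set.ncard_singleton]
      · rw [hset {q} (by simp [hlt.le, hlt]), Set.ncard_singleton]

end ArcMinimizers

section ArcMeasure

/-- The arc of parameters `x = (ρ s, ρ (1 - s))` of the measures for `β` with exactly one atom of
size two, of density `ρ` and with `X² = s`, whose other atoms have size one. -/
def feasibleArc (β : Word → ℝ) : Set (ℝ × ℝ) :=
  hyperbolaArc (β [X, X, Y, Y]) (β [X, X] - |β [X]|) (β [Y, Y] - |β [Y]|)

/-- The number of atoms of size one of the measure with parameter `x`. -/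
noncomputable def pointCount (β : Word → ℝ) : ℝ × ℝ → ℕ :=
  remainderCount (β [X, X] - |β [X]|) (β [Y, Y] - |β [Y]|) (if β [X] = 0 then 0 else 1)
    (if β [Y] = 0 then 0 else 1)

/-- The densities of the atoms `circleFamily s` in the measure for `β` with parameter `x`. -/
noncomputable def arcWeight (β : Word → ℝ) (x : ℝ × ℝ) : Option (Fin 4) → ℝ
  | none => x.1 + x.2
  | some j => ![(β [X, X] - x.1 + β [X]) / 2, (β [X, X] - x.1 - β [X]) / 2,
      (β [Y, Y] - x.2 + β [Y]) / 2, (β [Y, Y] - x.2 - β [Y]) / 2] j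

variable {β : Word → ℝ} {x y : ℝ × ℝ}

theorem arcWeight_nonneg (hx : x ∈ feasibleArc β) (c : Option (Fin 4)) : 0 ≤ arcWeight β x c := by
  obtain ⟨⟨hx₁, hxX⟩, ⟨hx₂, hxY⟩, -⟩ := hx
  have hX := abs_le.1 (le_sub_comm.1 hxX)
  have hY := abs_le.1 (le_sub_comm.1 hxY)
  cases c with
  | none => exact (add_pos hx₁ hx₂).le
  | some j => fin_cases j <;> simp [arcWeight] <;> linarith

theorem sum_arcWeight (hβ : CircleRelations β) (x : ℝ × ℝ) : ∑ c, arcWeight β x c = 1 := by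
  simp only [Fintype.sum_option, Fin.sum_univ_four, arcWeight, hβ.apply_YY, cons_val]
  ring

theorem arcWeight_none_pos (hx : x ∈ feasibleArc β) : 0 < arcWeight β x none :=
  add_pos hx.1.1 hx.2.1.1

theorem card_pos_pair {p a u : ℝ} (h : u ≤ p - |a|) :
    ((if 0 < (p - u + a) / 2 then 1 else 0) + if 0 < (p - u - a) / 2 then 1 else 0) =
      if u = p - |a| then if a = 0 then 0 else 1 else 2 := by
  rcases abs_cases a with ⟨ha, _⟩ | ⟨ha, _⟩ <;> split_ifs <;> grind

theorem card_arcWeight_pos (hx : x ∈ feasibleArc β) (s : ℝ) :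
    (Finset.univ.filter fun c => 0 < arcWeight β x c ∧ (circleFamily s).size c = 1).card =
      pointCount β x := by
  rw [pointCount, remainderCount, ← card_pos_pair hx.1.2, ← card_pos_pair hx.2.1.2,
    Finset.card_filter, Fintype.sum_option, Fin.sum_univ_four]
  simp [arcWeight, circleFamily, add_assoc]

/-- The measure for `β` with parameter `x`. -/
noncomputable def arcMeasure (hβ : CircleRelations β) (hx : x ∈ feasibleArc β) : AtomicMeasure :=
  (circleFamily (x.1 / (x.1 + x.2))).ofWeights (arcWeight_nonneg hx) (sum_arcWeight hβ x)

theorem arcRatio_mem_Icc (hx : x ∈ feasibleArc β) :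
    0 ≤ x.1 / (x.1 + x.2) ∧ x.1 / (x.1 + x.2) ≤ 1 := by
  have hx₁ := hx.1.1
  have hx₂ := hx.2.1.1
  exact ⟨by positivity, div_le_one_of_le₀ (by linarith) (by positivity)⟩

theorem isCirclePair_arcMeasure (hβ : CircleRelations β) (hx : x ∈ feasibleArc β) :
    IsCirclePair (arcMeasure hβ hx).atomX (arcMeasure hβ hx).atomY := by
  have hatom (i : Fin (arcMeasure hβ hx).N) :
      IsCirclePair ((arcMeasure hβ hx).atomX i) ((arcMeasure hβ hx).atomY i) :=
    isCirclePair_circleFamily (arcRatio_mem_Icc hx).1 (arcRatio_mem_Icc hx).2 _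
  exact ⟨funext fun i => (hatom i).selfAdjoint_left, funext fun i => (hatom i).selfAdjoint_right,
    funext fun i => (hatom i).anticomm, funext fun i => (hatom i).sq_add_sq⟩

theorem represents_arcMeasure (hβ : CircleRelations β) (hx : x ∈ feasibleArc β) :
    (arcMeasure hβ hx).Represents β := by
  obtain ⟨hs₀, hs₁⟩ := arcRatio_mem_Icc hx
  have hxne := (add_pos hx.1.1 hx.2.1.1).ne'
  have hmul := hx.2.2
  intro w hw
  refine hβ.ext (AtomicMeasure.circleRelations_moment (isCirclePair_arcMeasure hβ hx)) ?_ ?_ ?_ ?_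
    hw <;> rw [arcMeasure, AtomFamily.moment_ofWeights]
  · rw [sum_circleFamily_X]
    simp only [arcWeight, cons_val]
    ring
  · rw [sum_circleFamily_Y]
    simp only [arcWeight, cons_val]
    ring
  · rw [sum_circleFamily_XX _ hs₀]
    simp only [arcWeight, cons_val]
    field_simp
    ring
  · rw [sum_circleFamily_XXYY _ hs₀ hs₁]
    simp only [arcWeight]
    field_simp
    linear_combination -hmul

theorem size_circleFamily_le_two (s : ℝ) (c : Option (Fin 4)) : (circleFamily s).size c ≤ 2 := by
  cases c <;> simp [circleFamily]

theorem size_circleFamily_eq_two_iff {s : ℝ} {c : Option (Fin 4)} :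
    (circleFamily s).size c = 2 ↔ c = none := by
  cases c <;> simp [circleFamily]

theorem atomCount_one_arcMeasure (hβ : CircleRelations β) (hx : x ∈ feasibleArc β) :
    (arcMeasure hβ hx).atomCount 1 = pointCount β x := by
  rw [arcMeasure, AtomFamily.atomCount_ofWeights, card_arcWeight_pos hx]

theorem atomCount_two_arcMeasure (hβ : CircleRelations β) (hx : x ∈ feasibleArc β) :
    (arcMeasure hβ hx).atomCount 2 = 1 := by
  rw [arcMeasure, AtomFamily.atomCount_ofWeights, Finset.card_eq_one]
  refine ⟨none, ?_⟩
  ext c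
  simp only [Finset.mem_filter_univ, size_circleFamily_eq_two_iff, Finset.mem_singleton,
    and_iff_right_iff_imp]
  exact fun hc => hc ▸ arcWeight_none_pos hx

theorem maxSize_arcMeasure (hβ : CircleRelations β) (hx : x ∈ feasibleArc β) :
    (arcMeasure hβ hx).maxSize = 2 := by
  refine le_antisymm (Finset.sup_le fun i _ => size_circleFamily_le_two (x.1 / (x.1 + x.2)) _) ?_
  obtain ⟨i, hi⟩ := Finset.card_pos.1 ((atomCount_two_arcMeasure hβ hx).symm ▸ one_pos)
  exact ((Finset.mem_filter_univ i).1 hi).symm.trans_le (AtomicMeasure.size_le_maxSize i)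

/-- The moments of degree at most four determine all densities except for one parameter. -/
theorem exists_eq_arcWeight (hβ : CircleRelations β) {s : ℝ} (hs₀ : 0 < s) (hs₁ : s < 1)
    {W : Option (Fin 4) → ℝ} (hnonneg : ∀ c, 0 ≤ W c) (hpos : 0 < W none) (hone : ∑ c, W c = 1)
    (hmoment : ∀ w : Word, w.length ≤ 4 →
      β w = ∑ c, W c * wordTrace ((circleFamily s).atomX c) ((circleFamily s).atomY c) w) :
    ∃ x ∈ feasibleArc β, x.1 / (x.1 + x.2) = s ∧ W = arcWeight β x := by
  have hX := (hmoment [X] (by simp)).trans (sum_circleFamily_X W)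
  have hY := (hmoment [Y] (by simp)).trans (sum_circleFamily_Y W)
  have hXX := (hmoment [X, X] (by simp)).trans (sum_circleFamily_XX W hs₀.le)
  have hXXYY := (hmoment [X, X, Y, Y] (by simp)).trans (sum_circleFamily_XXYY W hs₀.le hs₁.le)
  have hYY : β [Y, Y] = W none * (1 - s) + W (some 2) + W (some 3) := by
    simp only [Fintype.sum_option, Fin.sum_univ_four] at hone
    rw [hβ.apply_YY, hXX]
    linear_combination -hone
  have habs {u v : ℝ} (hu : 0 ≤ u) (hv : 0 ≤ v) : |u - v| ≤ u + v := by
    rw [abs_le]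
    constructor <;> linarith
  have hsum : W none * s + W none * (1 - s) = W none := by ring
  refine ⟨(W none * s, W none * (1 - s)),
    ⟨⟨mul_pos hpos hs₀, ?_⟩, ⟨mul_pos hpos (sub_pos.2 hs₁), ?_⟩, ?_⟩, ?_, funext fun c => ?_⟩
  · rw [hX, hXX]
    linarith [habs (hnonneg (some 0)) (hnonneg (some 1))]
  · rw [hY, hYY]
    linarith [habs (hnonneg (some 2)) (hnonneg (some 3))]
  · rw [hXXYY]
    ring
  · rw [hsum, mul_div_cancel_left₀ _ hpos.ne']
  · cases c with
    | none => exact hsum.symm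
    | some j => fin_cases j <;> simp [arcWeight] <;> linarith

end ArcMeasure

namespace AtomicMeasure

variable {β : Word → ℝ} {ν : AtomicMeasure}

namespace Represents

theorem isCirclePair_atom (hν : ν.Represents β) (hβ : CircleRelations β) (i : Fin ν.N) :
    IsCirclePair (ν.atomX i) (ν.atomY i) :=
  have h := hν.isCirclePair hβ
  ⟨congrFun h.selfAdjoint_left i, congrFun h.selfAdjoint_right i, congrFun h.anticomm i,
    congrFun h.sq_add_sq i⟩

theorem exists_mul_ne_zero (hν : ν.Represents β) (hd : β [X, X, Y, Y] ≠ 0) :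
    ∃ i, ν.atomX i * ν.atomY i ≠ 0 := by
  by_contra! hzero
  have hmul : ν.atomX * ν.atomY = 0 := funext hzero
  apply hd
  rw [← hν.state_sq_mul_sq, sq, sq, mul_assoc, ← mul_assoc ν.atomX ν.atomY, hmul, zero_mul,
    mul_zero, map_zero]

theorem two_le_size (hν : ν.Represents β) (hβ : CircleRelations β) {i : Fin ν.N}
    (hi : ν.atomX i * ν.atomY i ≠ 0) : 2 ≤ ν.size i := by
  by_contra! hlt
  have hsize : Subsingleton (Fin (ν.size i)) := Fin.subsingleton_iff_le_one.2 (by omega)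
  exact hi (hν.isCirclePair_atom hβ i).mul_eq_zero_of_subsingleton

theorem two_le_maxSize (hν : ν.Represents β) (hβ : CircleRelations β) (hd : β [X, X, Y, Y] ≠ 0) :
    2 ≤ ν.maxSize :=
  have ⟨i, hi⟩ := hν.exists_mul_ne_zero hd
  (hν.two_le_size hβ hi).trans (size_le_maxSize i)

theorem exists_isLabelling (hν : ν.Represents β) (hβ : CircleRelations β)
    (hd : β [X, X, Y, Y] ≠ 0) (hmax : ν.maxSize ≤ 2) (hcount : ν.atomCount 2 ≤ 1) :
    ∃ s, 0 < s ∧ s < 1 ∧ ∃ ℓ, (circleFamily s).IsLabelling ν ℓ ∧ ∃ i, ℓ i = none := by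
  obtain ⟨i, hi⟩ := hν.exists_mul_ne_zero hd
  have hsize : ν.size i = 2 := ((size_le_maxSize i).trans hmax).antisymm (hν.two_le_size hβ hi)
  obtain ⟨s, hs₀, hs₁, hconj⟩ :=
    (hν.isCirclePair_atom hβ i).exists_orthConjugate_irreducible hsize hi
  have hlabel (j : Fin ν.N) : ∃ c, (j = i → c = none) ∧
      OrthConjugate ((circleFamily s).atomX c) ((circleFamily s).atomY c)
        (ν.atomX j) (ν.atomY j) := by
    by_cases hj : j = i
    · exact ⟨none, fun _ => rfl, hj ▸ hconj⟩
    · have hne : ν.size j ≠ 2 := fun h => hj (Finset.card_le_one.1 hcount j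
        ((Finset.mem_filter_univ j).2 h) i ((Finset.mem_filter_univ i).2 hsize))
      have hone : ν.size j = 1 := by
        have := ν.size_pos j
        have := (size_le_maxSize j).trans hmax
        omega
      obtain ⟨k, hk⟩ := (hν.isCirclePair_atom hβ j).exists_orthConjugate_point hone s
      exact ⟨some k, fun h => absurd h hj, hk⟩
  choose ℓ hnone hℓ using hlabel
  exact ⟨s, hs₀, hs₁, ℓ, hℓ, i, hnone i rfl⟩

theorem exists_mem_feasibleArc (hν : ν.Represents β) (hβ : CircleRelations β)
    (hd : β [X, X, Y, Y] ≠ 0) (hmax : ν.maxSize ≤ 2) (hcount : ν.atomCount 2 ≤ 1) :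
    ∃ x, ∃ hx : x ∈ feasibleArc β, pointCount β x ≤ ν.atomCount 1 ∧
      (pointCount β x = ν.atomCount 1 → ν.OrthEquiv (arcMeasure hβ hx)) := by
  obtain ⟨s, hs₀, hs₁, ℓ, hℓ, hnone⟩ := hν.exists_isLabelling hβ hd hmax hcount
  have htotal : ∑ c, ν.labelWeight ℓ c = 1 := by
    simpa [ν.sum_density] using sum_labelWeight_mul ℓ fun _ => (1 : ℝ)
  obtain ⟨x, hx, rfl, hW⟩ := exists_eq_arcWeight hβ hs₀ hs₁ (labelWeight_nonneg ℓ)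
    (labelWeight_pos_iff.2 hnone) htotal fun w hw =>
      (hν w hw).trans (hℓ.sum_labelWeight_mul_wordTrace w).symm
  have hone := card_arcWeight_pos hx (x.1 / (x.1 + x.2))
  have htwo := atomCount_two_arcMeasure hβ hx
  rw [arcMeasure, AtomFamily.atomCount_ofWeights] at htwo
  rw [← hW] at hone htwo
  refine ⟨x, hx, hone.symm.trans_le (hℓ.card_label_le_atomCount 1), fun h => ?_⟩
  have hinj : ℓ.Injective := by
    refine hℓ.injective_of_card_label fun i => ?_
    have hi₀ := ν.size_pos i
    have hi₂ := (size_le_maxSize i).trans hmax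
    obtain hi | hi : ν.size i = 1 ∨ ν.size i = 2 := by omega
    · rw [hi, hone, h]
    · rw [hi]
      exact (hℓ.card_label_le_atomCount 2).antisymm (hcount.trans_eq htwo.symm)
  exact hℓ.orthEquiv (AtomFamily.isLabelling_ofWeights _ _ _) hinj
    (AtomFamily.ofWeightsLabel_injective ..) (hW.trans (AtomFamily.labelWeight_ofWeights ..).symm)

end Represents

end AtomicMeasure

section Minimal

variable {β : Word → ℝ} {μ ν : AtomicMeasure} {x y : ℝ × ℝ}

theorem AtomicMeasure.Represents.nonempty_feasibleArc (hν : ν.Represents β)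
    (hβ : CircleRelations β) (hd : β [X, X, Y, Y] ≠ 0) : (feasibleArc β).Nonempty :=
  nonempty_hyperbolaArc_of_forall_le ((hν.apply_XXYY_nonneg hβ).lt_of_ne' hd)
    (hν.apply_XXYY_le hβ)

theorem density_mul_wordTrace_of_size_eq_two {hβ : CircleRelations β} {hx : x ∈ feasibleArc β}
    {i : Fin (arcMeasure hβ hx).N} (hi : (arcMeasure hβ hx).size i = 2) :
    (arcMeasure hβ hx).density i *
      wordTrace ((arcMeasure hβ hx).atomX i) ((arcMeasure hβ hx).atomY i) [X, X] = x.1 := by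
  obtain ⟨c, hsize, hdensity, htrace⟩ := (circleFamily (x.1 / (x.1 + x.2))).exists_atom_ofWeights
    (arcWeight_nonneg hx) (sum_arcWeight hβ x) i
  obtain rfl : c = none := size_circleFamily_eq_two_iff.1 (hsize.symm.trans hi)
  have hne := (arcWeight_none_pos hx).ne'
  have hword {s : ℝ} (hs : 0 ≤ s) : wordTrace (irreducibleX s) (irreducibleY s) [X, X] = s := by
    simp [wordTrace, irreducibleX_mul_self hs]
  calc _ = (x.1 + x.2) * (x.1 / (x.1 + x.2)) :=
        congrArg₂ _ hdensity ((htrace _).trans (hword (arcRatio_mem_Icc hx).1))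
    _ = x.1 := mul_div_cancel₀ _ hne

theorem eq_of_orthEquiv_arcMeasure {hβ : CircleRelations β} {hx : x ∈ feasibleArc β}
    {hy : y ∈ feasibleArc β} (h : (arcMeasure hβ hx).OrthEquiv (arcMeasure hβ hy)) : x = y := by
  obtain ⟨σ, hσ⟩ := h
  obtain ⟨i, hi⟩ := Finset.card_pos.1 ((atomCount_two_arcMeasure hβ hx).symm ▸ one_pos)
  have hi₂ := (Finset.mem_filter_univ i).1 hi
  obtain ⟨hdensity, hconj : OrthConjugate _ _ _ _⟩ := hσ i
  have hx₁ := density_mul_wordTrace_of_size_eq_two hi₂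
  have hy₁ := density_mul_wordTrace_of_size_eq_two (hconj.size_eq.trans hi₂)
  rw [← hdensity, hconj.wordTrace_eq, hx₁] at hy₁
  exact eq_of_mem_hyperbolaArc_of_fst_eq hx hy hy₁

theorem isMinimal_arcMeasure (hβ : CircleRelations β) (hx : x ∈ feasibleArc β)
    (hmin : IsMinOn (pointCount β) (feasibleArc β) x) : (arcMeasure hβ hx).IsMinimal β := by
  refine ⟨represents_arcMeasure hβ hx, fun ν hν hsmaller => ?_⟩
  have hd := (pos_of_mem_hyperbolaArc hx).ne'
  have hmax : ν.maxSize = 2 := by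
    have htwo := hν.two_le_maxSize hβ hd
    have hle := hsmaller.elim le_of_lt fun h => h.1.le
    exact (hle.trans_eq (maxSize_arcMeasure hβ hx)).antisymm htwo
  have hcount := hmax ▸ ν.atomCount_maxSize_pos
  rw [AtomicMeasure.smallerType_iff_of_maxSize_eq_two (maxSize_arcMeasure hβ hx) hmax,
    atomCount_two_arcMeasure, atomCount_one_arcMeasure] at hsmaller
  obtain hlt | ⟨heq, hlt⟩ := hsmaller
  · omega
  · obtain ⟨y, hy, hle, -⟩ := hν.exists_mem_feasibleArc hβ hd hmax.le heq.le
    exact (hle.trans_lt hlt).not_ge (isMinOn_iff.1 hmin y hy)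

theorem AtomicMeasure.IsMinimal.exists_orthEquiv_arcMeasure (hν : ν.IsMinimal β)
    (hβ : CircleRelations β) (hd : β [X, X, Y, Y] ≠ 0) :
    ∃ x, ∃ hx : x ∈ feasibleArc β, IsMinOn (pointCount β) (feasibleArc β) x ∧
      ν.OrthEquiv (arcMeasure hβ hx) := by
  obtain ⟨hrep, hmin⟩ := hν
  have hnot (z) (hz : z ∈ feasibleArc β) := hmin _ (represents_arcMeasure hβ hz)
  obtain ⟨z, hz⟩ := hrep.nonempty_feasibleArc hβ hd
  have hmax : ν.maxSize = 2 := by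
    refine le_antisymm (not_lt.1 fun h => hnot z hz (.inl ?_)) (hrep.two_le_maxSize hβ hd)
    exact (maxSize_arcMeasure hβ hz).trans_lt h
  have hle (z) (hz : z ∈ feasibleArc β) :
      ν.atomCount 2 ≤ 1 ∧ (1 = ν.atomCount 2 → ν.atomCount 1 ≤ pointCount β z) := by
    simpa [AtomicMeasure.smallerType_iff_of_maxSize_eq_two hmax (maxSize_arcMeasure hβ hz),
      atomCount_two_arcMeasure, atomCount_one_arcMeasure] using hnot z hz
  have htwo : 1 = ν.atomCount 2 :=
    (Nat.succ_le_of_lt (hmax ▸ ν.atomCount_maxSize_pos)).antisymm (hle z hz).1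
  obtain ⟨x, hx, hcount, hequiv⟩ :=
    hrep.exists_mem_feasibleArc hβ hd hmax.le htwo.symm.le
  exact ⟨x, hx, isMinOn_iff.2 fun z hz => hcount.trans ((hle z hz).2 htwo),
    hequiv (hcount.antisymm ((hle x hx).2 htwo))⟩

theorem type_arcMeasure (hβ : CircleRelations β) (hx : x ∈ feasibleArc β) :
    (arcMeasure hβ hx).type = [pointCount β x, 1] := by
  rw [AtomicMeasure.type_eq_of_maxSize_eq_two (maxSize_arcMeasure hβ hx),
    atomCount_one_arcMeasure, atomCount_two_arcMeasure]

theorem admitsNCMeasure_iff_nonempty (hβ : CircleRelations β) (hd : β [X, X, Y, Y] ≠ 0) :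
    AdmitsNCMeasure β ↔ (feasibleArc β).Nonempty := by
  refine ⟨fun ⟨ν, hν, _⟩ => hν.1.nonempty_feasibleArc hβ hd, fun hne => ?_⟩
  have hx := Function.argminOn_mem (pointCount β) (feasibleArc β) hne
  refine ⟨arcMeasure hβ hx, isMinimal_arcMeasure hβ hx (isMinOn_iff.2 fun y hy => ?_), ?_⟩
  · exact Function.argminOn_le _ _ hy
  · rw [maxSize_arcMeasure]
    exact one_lt_two

theorem hasUniqueMinimal_iff_hasMinimizers (hβ : CircleRelations β) (hd : β [X, X, Y, Y] ≠ 0)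
    {m : ℕ} :
    HasUniqueMinimal β [m, 1] ↔ HasMinimizers (pointCount β) (feasibleArc β) 1 m := by
  constructor
  · rintro ⟨μ, hμ, htype, hunique⟩
    obtain ⟨x, hx, hxmin, hμx⟩ := hμ.exists_orthEquiv_arcMeasure hβ hd
    have hargmin (y) (hy : y ∈ feasibleArc β) (hymin : IsMinOn (pointCount β) (feasibleArc β) y) :
        y = x :=
      eq_of_orthEquiv_arcMeasure ((hunique _ (isMinimal_arcMeasure hβ hy hymin)).trans hμx)
    rw [hμx.type_eq, type_arcMeasure] at htype
    refine ⟨Set.ncard_eq_one.2 ⟨x, ?_⟩, fun y hy hymin => ?_⟩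
    · exact Set.eq_singleton_iff_unique_mem.2 ⟨⟨hx, hxmin⟩, fun y hy => hargmin y hy.1 hy.2⟩
    · rw [hargmin y hy hymin]
      simpa using htype
  · rintro ⟨hcard, hcount⟩
    obtain ⟨x, hxset⟩ := Set.ncard_eq_one.1 hcard
    obtain ⟨⟨hx, hxmin⟩, hunique⟩ := Set.eq_singleton_iff_unique_mem.1 hxset
    refine ⟨arcMeasure hβ hx, isMinimal_arcMeasure hβ hx hxmin, ?_, fun ν hν => ?_⟩
    · rw [type_arcMeasure, hcount x hx hxmin]
    · obtain ⟨y, hy, hymin, hνy⟩ := hν.exists_orthEquiv_arcMeasure hβ hd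
      obtain rfl := hunique y ⟨hy, hymin⟩
      exact hνy

theorem hasExactlyTwoMinimal_iff_hasMinimizers (hβ : CircleRelations β)
    (hd : β [X, X, Y, Y] ≠ 0) {m : ℕ} :
    HasExactlyTwoMinimal β [m, 1] ↔ HasMinimizers (pointCount β) (feasibleArc β) 2 m := by
  constructor
  · rintro ⟨μ₁, μ₂, hμ₁, hμ₂, htype₁, htype₂, hne, hpair⟩
    obtain ⟨x, hx, hxmin, hμx⟩ := hμ₁.exists_orthEquiv_arcMeasure hβ hd
    obtain ⟨y, hy, hymin, hμy⟩ := hμ₂.exists_orthEquiv_arcMeasure hβ hd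
    have hxy : x ≠ y := by
      rintro rfl
      exact hne (hμx.trans hμy.symm)
    have hargmin (z) (hz : z ∈ feasibleArc β) (hzmin : IsMinOn (pointCount β) (feasibleArc β) z) :
        z = x ∨ z = y :=
      (hpair _ (isMinimal_arcMeasure hβ hz hzmin)).imp
        (fun h => eq_of_orthEquiv_arcMeasure (h.trans hμx))
        (fun h => eq_of_orthEquiv_arcMeasure (h.trans hμy))
    rw [hμx.type_eq, type_arcMeasure] at htype₁
    rw [hμy.type_eq, type_arcMeasure] at htype₂
    refine ⟨Set.ncard_eq_two.2 ⟨x, y, hxy, Set.Subset.antisymm ?_ ?_⟩, fun z hz hzmin => ?_⟩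
    · exact fun z hz => hargmin z hz.1 hz.2
    · rintro z (rfl | rfl)
      exacts [⟨hx, hxmin⟩, ⟨hy, hymin⟩]
    · obtain rfl | rfl := hargmin z hz hzmin
      exacts [List.head_eq_of_cons_eq htype₁, List.head_eq_of_cons_eq htype₂]
  · rintro ⟨hcard, hcount⟩
    obtain ⟨x, y, hxy, hset⟩ := Set.ncard_eq_two.1 hcard
    obtain ⟨hx, hxmin⟩ := hset.ge (.inl rfl)
    obtain ⟨hy, hymin⟩ := hset.ge (.inr rfl)
    refine ⟨arcMeasure hβ hx, arcMeasure hβ hy, isMinimal_arcMeasure hβ hx hxmin,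
      isMinimal_arcMeasure hβ hy hymin, ?_, ?_, fun h => hxy (eq_of_orthEquiv_arcMeasure h),
      fun ν hν => ?_⟩
    · rw [type_arcMeasure, hcount x hx hxmin]
    · rw [type_arcMeasure, hcount y hy hymin]
    · obtain ⟨z, hz, hzmin, hνz⟩ := hν.exists_orthEquiv_arcMeasure hβ hd
      obtain rfl | rfl : z = x ∨ z = y := hset.le ⟨hz, hzmin⟩
      exacts [.inl hνz, .inr hνz]

end Minimal

section Classification

variable {β : Word → ℝ}

theorem lowerBound_eq (hβ : CircleRelations β)
    (h : 0 < (β [X, X] - |β [X]|) + (β [Y, Y] - |β [Y]|)) :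
    lowerBound β = β [X, X] - (β [X, X] - |β [X]|) * (β [Y, Y] - |β [Y]|) /
      ((β [X, X] - |β [X]|) + (β [Y, Y] - |β [Y]|)) := by
  rw [hβ.apply_YY] at h ⊢
  have hden : -1 + |β [Y]| + |β [X]| ≠ 0 := by linarith
  rw [lowerBound, abs_mul]
  field_simp
  ring

theorem lowerBound_le_iff (hβ : CircleRelations β)
    (h : 0 < (β [X, X] - |β [X]|) + (β [Y, Y] - |β [Y]|)) :
    lowerBound β ≤ β [X, X, X, X] ↔
      β [X, X, Y, Y] * ((β [X, X] - |β [X]|) + (β [Y, Y] - |β [Y]|)) ≤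
        (β [X, X] - |β [X]|) * (β [Y, Y] - |β [Y]|) := by
  rw [lowerBound_eq hβ h, hβ.apply_XXXX, ← le_div_iff₀ h, sub_le_sub_iff_left]

theorem eq_lowerBound_iff (hβ : CircleRelations β)
    (h : 0 < (β [X, X] - |β [X]|) + (β [Y, Y] - |β [Y]|)) :
    β [X, X, X, X] = lowerBound β ↔
      β [X, X, Y, Y] * ((β [X, X] - |β [X]|) + (β [Y, Y] - |β [Y]|)) =
        (β [X, X] - |β [X]|) * (β [Y, Y] - |β [Y]|) := by
  rw [lowerBound_eq hβ h, hβ.apply_XXXX, ← eq_div_iff h.ne', sub_right_inj]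

theorem nonempty_feasibleArc_iff (hβ : CircleRelations β) :
    (feasibleArc β).Nonempty ↔
      |β [Y]| < 1 - |β [X]| ∧
      (|β [X]| < β [X, X] ∧ β [X, X] < 1 - |β [Y]|) ∧
      (lowerBound β ≤ β [X, X, X, X] ∧ β [X, X, X, X] < β [X, X]) := by
  have hYY := hβ.apply_YY
  have hXXXX := hβ.apply_XXXX
  rw [feasibleArc, nonempty_hyperbolaArc_iff]
  constructor
  · rintro ⟨hd, hR, hS, hle⟩
    exact ⟨by linarith, ⟨by linarith, by linarith⟩,
      (lowerBound_le_iff hβ (add_pos hR hS)).2 hle, by linarith⟩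
  · rintro ⟨-, ⟨hX, hY⟩, hle, hlt⟩
    have hR : 0 < β [X, X] - |β [X]| := by linarith
    have hS : 0 < β [Y, Y] - |β [Y]| := by linarith
    exact ⟨by linarith, hR, hS, (lowerBound_le_iff hβ (add_pos hR hS)).1 hle⟩

theorem hasMinimizers_feasibleArc_of_eq (hβ : CircleRelations β) (h : (feasibleArc β).Nonempty)
    (hq : β [X, X, X, X] = lowerBound β) :
    HasMinimizers (pointCount β) (feasibleArc β) 1
      ((if β [X] = 0 then 0 else 1) + if β [Y] = 0 then 0 else 1) := by
  obtain ⟨-, hR, hS, -⟩ := nonempty_hyperbolaArc_iff.1 h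
  exact hasMinimizers_of_corner hR hS _ _ ((eq_lowerBound_iff hβ (add_pos hR hS)).1 hq)

theorem hasMinimizers_feasibleArc_of_ne (hβ : CircleRelations β) (h : (feasibleArc β).Nonempty)
    (hq : β [X, X, X, X] ≠ lowerBound β) :
    HasMinimizers (pointCount β) (feasibleArc β) (if β [X] = 0 ↔ β [Y] = 0 then 2 else 1)
      (if β [X] = 0 ∨ β [Y] = 0 then 2 else 3) := by
  obtain ⟨hd, hR, hS, hle⟩ := nonempty_hyperbolaArc_iff.1 h
  have hlt := hle.lt_of_ne (mt (eq_lowerBound_iff hβ (add_pos hR hS)).2 hq)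
  have := hasMinimizers_of_lt hd hR hS (m := if β [X] = 0 then 0 else 1)
    (n := if β [Y] = 0 then 0 else 1) (by split_ifs <;> simp) (by split_ifs <;> simp) hlt
  by_cases hX : β [X] = 0 <;> by_cases hY : β [Y] = 0 <;>
    simpa [pointCount, feasibleArc, hX, hY] using this

theorem rank_le_card_of_col_mem_span {m n ι : Type*} [Finite m] [Fintype n] [Fintype ι]
    {A : Matrix m n ℝ} (f : ι → n)
    (h : ∀ j, A.col j ∈ Submodule.span ℝ (Set.range (A.col ∘ f))) :
    A.rank ≤ Fintype.card ι := by
  rw [rank_eq_finrank_span_cols]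
  exact (Submodule.finrank_mono (Submodule.span_le.2 (Set.range_subset_iff.2 h))).trans
    (finrank_range_le_card _)

theorem col_XX_eq_smul_col_one (hβ : CircleRelations β) (hX : β [X] = 0) (hY : β [Y] = 0)
    (hq : β [X, X, X, X] = lowerBound β) :
    (momentMatrix β).col 3 = β [X, X] • (momentMatrix β).col 0 := by
  have hd : β [X, X, Y, Y] = β [X, X] - β [X, X] ^ 2 := by
    have : lowerBound β = β [X, X] ^ 2 := by simp [lowerBound, hX, hY]
    linarith [hβ.apply_XXXX]
  funext i
  change β ((wordsTwo i).reverse ++ [X, X]) = β [X, X] * β ((wordsTwo i).reverse ++ [])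
  have hlen : (wordsTwo i).reverse.length ≤ 2 := by fin_cases i <;> simp [wordsTwo]
  rw [hβ.eq_circleValue (w := _ ++ [X, X]) (by simpa using hlen),
    hβ.eq_circleValue (w := _ ++ []) (by simp at hlen ⊢; omega), hX, hY, hd]
  fin_cases i <;> simp [wordsTwo, CircleRelations.circleValue] <;> ring

theorem rank_momentMatrix_le_four (hβ : CircleRelations β)
    (hXY : (momentMatrix β).col 4 + (momentMatrix β).col 5 = 0)
    (hXX : (momentMatrix β).col 3 + (momentMatrix β).col 6 = (momentMatrix β).col 0)
    (hX : β [X] = 0) (hY : β [Y] = 0) (hq : β [X, X, X, X] = lowerBound β) :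
    (momentMatrix β).rank ≤ 4 := by
  let basis : Fin 4 → Fin 7 := ![0, 1, 2, 4]
  have hmem (k : Fin 4) : (momentMatrix β).col (basis k) ∈
      Submodule.span ℝ (Set.range ((momentMatrix β).col ∘ basis)) :=
    Submodule.subset_span ⟨k, rfl⟩
  have h3 := col_XX_eq_smul_col_one hβ hX hY hq ▸ Submodule.smul_mem _ (β [X, X]) (hmem 0)
  have h5 := eq_neg_of_add_eq_zero_right hXY ▸ Submodule.neg_mem _ (hmem 3)
  have h6 := eq_sub_of_add_eq' hXX ▸ Submodule.sub_mem _ (hmem 0) h3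
  refine rank_le_card_of_col_mem_span basis fun j => ?_
  fin_cases j
  exacts [hmem 0, hmem 1, hmem 2, h3, hmem 3, h5, h6]

end Classification

end TracialMoment

open TracialMoment Letter in
theorem theorem6p4 (β : Word → ℝ) (htracial : IsTracial β) (hnorm : IsNormalized β)
    (hnc : IsNoncommutative β) (hrank : (momentMatrix β).rank = 5)
    -- the column relations XY + YX = 0 and X² + Y² = 1
    (hXY : (momentMatrix β).col 4 + (momentMatrix β).col 5 = 0)
    (hXX : (momentMatrix β).col 3 + (momentMatrix β).col 6 = (momentMatrix β).col 0) :
    (AdmitsNCMeasure β ↔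
      |β [Y]| < 1 - |β [X]| ∧
      (|β [X]| < β [X, X] ∧ β [X, X] < 1 - |β [Y]|) ∧
      (lowerBound β ≤ β [X, X, X, X] ∧ β [X, X, X, X] < β [X, X])) ∧
    (AdmitsNCMeasure β →
      (HasUniqueMinimal β [1, 1] ↔
        β [X] * β [Y] = 0 ∧ β [X, X, X, X] = lowerBound β) ∧
      (HasUniqueMinimal β [2, 1] ↔
        (β [X] * β [Y] = 0 ∧ (β [X] ≠ 0 ∨ β [Y] ≠ 0) ∧ β [X, X, X, X] ≠ lowerBound β) ∨
        (β [X] * β [Y] ≠ 0 ∧ β [X, X, X, X] = lowerBound β)) ∧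
      (HasExactlyTwoMinimal β [2, 1] ↔ β [X] = 0 ∧ β [Y] = 0) ∧
      (HasExactlyTwoMinimal β [3, 1] ↔
        β [X] * β [Y] ≠ 0 ∧ β [X, X, X, X] ≠ lowerBound β)) := by
  have hβ := CircleRelations.of_momentMatrix htracial hnorm hXY hXX
  have hd : β [X, X, Y, Y] ≠ 0 := fun h => hnc (by rw [hβ.apply_XYXY, h, neg_zero])
  have hnondegenerate : β [X, X, X, X] = lowerBound β → ¬ (β [X] = 0 ∧ β [Y] = 0) :=
    fun hq ⟨hX, hY⟩ => by
      have := rank_momentMatrix_le_four hβ hXY hXX hX hY hq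
      omega
  refine ⟨(admitsNCMeasure_iff_nonempty hβ hd).trans (nonempty_feasibleArc_iff hβ), fun hadm => ?_⟩
  have hne := (admitsNCMeasure_iff_nonempty hβ hd).1 hadm
  simp only [hasUniqueMinimal_iff_hasMinimizers hβ hd, hasExactlyTwoMinimal_iff_hasMinimizers hβ hd]
  by_cases hq : β [X, X, X, X] = lowerBound β
  · have h := hasMinimizers_feasibleArc_of_eq hβ hne hq
    simp only [h.iff_eq one_ne_zero]
    by_cases hX : β [X] = 0 <;> by_cases hY : β [Y] = 0
    · exact absurd ⟨hX, hY⟩ (hnondegenerate hq)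
    all_goals simp [hX, hY, hq]
  · have h := hasMinimizers_feasibleArc_of_ne hβ hne hq
    simp only [h.iff_eq (by split_ifs <;> simp)]
    by_cases hX : β [X] = 0 <;> by_cases hY : β [Y] = 0 <;> simp [hX, hY, hq]
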